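/- Let $X$ be a (real or complex) Banach space and let $(x_n)_{n}$ be a Schauder basis of $X$. A basic sequence $(u_n)_n$ in $X$ (i.e. a Schauder basis of its closed linear span) is called RUC if, for all scalars $(a_n)_n$, convergence of $\sum_n a_n u_n$ implies that $\sum_n \varepsilon_n a_n u_n$ converges for almost every $(\varepsilon_n)_n\in\{-1,1\}^{\mathbb N}$ with respect to the Haar (uniform product) probability measure; it is called RUD if, for all scalars $(a_n)_n$, convergence of $\sum_n \varepsilon_n a_n u_n$ for almost every $(\varepsilon_n)_n$ implies convergence of $\sum_n a_n u_n$. A block subsequence of $(x_n)_n$ is a sequence of nonzero vectors $u_j=\sum_{n=p_j}^{p_{j+1}-1} a_n x_n$, where $p_0<p_1<\cdots$ are indices and the $a_n$ are scalars. The basis $(x_n)_n$ is shrinking if its biorthogonal functionals form a Schauder basis of $X^*$, and boundedly complete if $\sum_n a_n x_n$ converges whenever its partial sums are bounded. 1. Suppose that every block subsequence of $(x_n)_n$ is RUD. Then $(x_n)_n$ is shrinking if and only if $X$ does not contain a subspace isomorphic to $\ell_1$. 2. Suppose that every block subsequence of $(x_n)_n$ is RUC. Then $(x_n)_n$ is boundedly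 complete if and only if $X$ does not contain a subspace isomorphic to $c_0$. Here $\ell_1$ and $c_0$ are taken over the scalar field of $X$, and isomorphic means linearly homeomorphic. -/

import Mathlib

open MeasureTheory Filter Topology
open scoped ZeroAtInfty

/-- The series `∑ y n` converges (in norm, in the given order). -/
def SeriesConverges {X : Type*} [NormedAddCommGroup X] (y : ℕ → X) : Prop :=
  ∃ v : X, Tendsto (fun n : ℕ => ∑ i ∈ Finset.range n, y i) atTop (𝓝 v)

/-- The Haar (uniform product) probability measure on the sign sequences `{-1, 1}^ℕ`;
the two-point group `{-1, 1}` is `ℤˣ`. -/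
noncomputable def signMeasure : Measure (ℕ → ℤˣ) :=
  Measure.infinitePi fun _ : ℕ => (PMF.uniformOfFintype ℤˣ).toMeasure

/-- The series `∑ y n` is randomly unconditionally convergent: `∑ ε n • y n` converges for almost
every sequence of signs `ε`. -/
def RandomlyUnconditionallyConvergent {X : Type*} [NormedAddCommGroup X] (y : ℕ → X) : Prop :=
  ∀ᵐ ε ∂signMeasure, SeriesConverges fun n => ε n • y n

section

variable (𝕜 : Type*) [RCLike 𝕜] {X : Type*} [NormedAddCommGroup X] [NormedSpace 𝕜 X]

/-- `u` is a basic sequence: a Schauder basis of its closed linear span. -/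
def IsBasicSequence (u : ℕ → X) : Prop :=
  ∃ b : SchauderBasis 𝕜 (Submodule.span 𝕜 (Set.range u)).topologicalClosure,
    ∀ n, ((b n : (Submodule.span 𝕜 (Set.range u)).topologicalClosure) : X) = u n

/-- A basic sequence of Random Unconditional Convergence. -/
structure IsRUC (u : ℕ → X) : Prop where
  basic : IsBasicSequence 𝕜 u
  randomly_convergent : ∀ a : ℕ → 𝕜, SeriesConverges (fun n => a n • u n) →
    RandomlyUnconditionallyConvergent fun n => a n • u n

/-- A basic sequence of Random Unconditional Divergence. -/
structure IsRUD (u : ℕ → X) : Prop where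
  basic : IsBasicSequence 𝕜 u
  convergent : ∀ a : ℕ → 𝕜, RandomlyUnconditionallyConvergent (fun n => a n • u n) →
    SeriesConverges fun n => a n • u n

/-- `u` is a block subsequence of `x`: nonzero vectors
`u j = ∑_{p j ≤ n < p (j + 1)} a n • x n` with `p 0 < p 1 < ⋯`. Gaps between the supports of
consecutive blocks are covered, since the coefficients may vanish. -/
def IsBlockSubsequence (x u : ℕ → X) : Prop :=
  ∃ (p : ℕ → ℕ) (a : ℕ → 𝕜), StrictMono p ∧
    ∀ j, u j = ∑ n ∈ Finset.Ico (p j) (p (j + 1)), a n • x n ∧ u j ≠ 0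

/-- `X` contains a linear subspace isomorphic, as a topological vector space, to `E`. -/
def ContainsIsomorphicCopy (X : Type*) [NormedAddCommGroup X] [NormedSpace 𝕜 X]
    (E : Type*) [NormedAddCommGroup E] [NormedSpace 𝕜 E] : Prop :=
  ∃ Y : Submodule 𝕜 X, Nonempty (Y ≃L[𝕜] E)

variable {𝕜}

/-- A Schauder basis is shrinking if its biorthogonal functionals form a Schauder basis of the
dual space. -/
def IsShrinking (x : SchauderBasis 𝕜 X) : Prop :=
  ∃ c : SchauderBasis 𝕜 (StrongDual 𝕜 X), ∀ n, c n = x.coord n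

/-- A Schauder basis is boundedly complete if every series `∑ a n • x n` with bounded partial sums
converges. -/
def IsBoundedlyComplete (x : SchauderBasis 𝕜 X) : Prop :=
  ∀ a : ℕ → 𝕜, (∃ M : ℝ, ∀ n : ℕ, ‖∑ i ∈ Finset.range n, a i • x i‖ ≤ M) →
    SeriesConverges fun n => a n • x n

end

/-! Two implications need no hypothesis on blocks. A shrinking basis makes the dual separable, while
a copy of ℓ₁ carries the functionals "sum over A", A ⊆ ℕ, whose Hahn–Banach extensions are uniformly
separated. In a copy of c₀ the unit vectors are null in every coordinate, so a gliding hump replaces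
a subsequence by blocks with bounded sums whose norms do not tend to 0.

RUC and c₀. If bounded completeness fails, some blocks u_j are bounded below and have bounded
partial sums. By Dirichlet's test ∑ f_j u_j converges whenever f decreases to 0; RUC and a
Borel–Cantelli argument then show that the partial sums of ∑ ε_j u_j are almost surely bounded. A
common bound holds on a set of signs of measure above 1/2. Along a sparse subsequence this set meets
its reflections with arbitrary prescribed signs, and averaging a point with its reflection deletes
all other terms. The subsequence thus has bounded sums for all signs, and spans c₀.

RUD and ℓ₁. If the tails of a functional f do not tend to 0 in norm, then f = 1 on a bounded
sequence of blocks u_j. Without ℓ₁, Rosenthal's theorem (via Galvin's lemma) gives a subsequence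
with small oscillation at each functional; convex combinations, taken on the weak-* compact dual
ball, make this uniform, and the remainder is a scalar Rademacher average, small by Khinchine. So
there are successive combinations of the u_j, with coefficients of sum 1, whose randomly signed
versions have mean norm at most 2⁻ᵏ. Concatenated, they form a series that converges for almost all
signs, yet diverges unsigned because f is 1 on each piece: this contradicts RUD. -/

/-! ### Ramsey theory: Galvin's lemma and Rosenthal's dichotomy -/

/-- Diagonalization over the infinite sets of natural numbers: a hereditary property of pairs
`(s, M)` which can be attained, for each `s`, by shrinking `M`, holds on the tails of a single
infinite set `L` for all finite subsets `s` of `L`. -/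
theorem exists_infinite_subset_forall_tail {D : Finset ℕ → Set ℕ → Prop}
    (hmono : ∀ s M N, N ⊆ M → D s M → D s N)
    (hdense : ∀ s (M : Set ℕ), M.Infinite → ∃ N ⊆ M, N.Infinite ∧ D s N)
    {M : Set ℕ} (hM : M.Infinite) :
    ∃ L ⊆ M, L.Infinite ∧ ∀ s : Finset ℕ, (s : Set ℕ) ⊆ L → D s {n ∈ L | ∀ m ∈ s, m < n} := by
  have hfin : ∀ (T : Finset (Finset ℕ)) (M : Set ℕ), M.Infinite →
      ∃ N ⊆ M, N.Infinite ∧ ∀ s ∈ T, D s N := by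
    intro T
    induction T using Finset.induction_on with
    | empty => exact fun M hM => ⟨M, subset_rfl, hM, by simp⟩
    | insert a T _ ih =>
      intro M hM
      obtain ⟨N, hNM, hN, hD⟩ := ih M hM
      obtain ⟨N', hN'N, hN', hD'⟩ := hdense a N hN
      refine ⟨N', hN'N.trans hNM, hN', ?_⟩
      intro s hs
      rcases Finset.mem_insert.1 hs with rfl | hs
      · exact hD'
      · exact hmono _ _ _ hN'N (hD s hs)
  -- Here `n` is the next point of `L`; only finitely many `s` have all elements at most `n`, so one
  -- shrinking settles them all.
  have hstep : ∀ M : {M : Set ℕ // M.Infinite}, ∃ n ∈ M.1, ∃ N : {M : Set ℕ // M.Infinite},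
      N.1 ⊆ M.1 ∧ (∀ x ∈ N.1, n < x) ∧ ∀ s ⊆ Finset.range (n + 1), D s N.1 := by
    rintro ⟨M, hM⟩
    obtain ⟨n, hn⟩ := hM.nonempty
    have hM' : (M \ Set.Iic n).Infinite := hM.sdiff (Set.finite_Iic n)
    obtain ⟨N, hNM, hN, hD⟩ := hfin (Finset.range (n + 1)).powerset _ hM'
    refine ⟨n, hn, ⟨N, hN⟩, fun x hx => (hNM hx).1, fun x hx => by simpa using (hNM hx).2, ?_⟩
    exact fun s hs => hD s (Finset.mem_powerset.2 hs)
  choose pt hpt nxt hsub hlt hD using hstep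
  -- The empty set has no maximum at which to be treated, so it is settled before the recursion.
  obtain ⟨M₀, hM₀M, hM₀, hD₀⟩ := hdense ∅ M hM
  let seq : ℕ → {M : Set ℕ // M.Infinite} := fun i => nxt^[i] ⟨M₀, hM₀⟩
  have hseq : ∀ i, seq (i + 1) = nxt (seq i) := fun i => Function.iterate_succ_apply' _ _ _
  have hanti : Antitone fun i => (seq i).1 :=
    antitone_nat_of_succ_le fun i => by rw [hseq]; exact hsub _
  let f : ℕ → ℕ := fun i => pt (seq i)
  have hf : StrictMono f := strictMono_nat_of_lt_succ fun i => by
    apply hlt (seq i)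
    rw [← hseq]
    exact hpt _
  refine ⟨Set.range f, ?_, Set.infinite_range_of_injective hf.injective, ?_⟩
  · rintro _ ⟨i, rfl⟩
    exact hM₀M (hanti (Nat.zero_le i) (hpt (seq i)))
  · intro s hs
    rcases s.eq_empty_or_nonempty with rfl | hne
    · refine hmono _ _ _ ?_ hD₀
      rintro _ ⟨⟨i, rfl⟩, -⟩
      exact hanti (Nat.zero_le i) (hpt (seq i))
    · obtain ⟨i, hi⟩ := hs (s.max'_mem hne)
      refine hmono _ _ _ ?_ (hD (seq i) s ?_)
      · rintro _ ⟨⟨j, rfl⟩, hj⟩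
        have : f i < f j := hi ▸ hj _ (s.max'_mem hne)
        rw [← hseq]
        exact hanti (Nat.succ_le_of_lt (hf.lt_iff_lt.1 this)) (hpt (seq j))
      · intro x hx
        have := s.le_max' x hx
        rw [← hi] at this
        exact Finset.mem_range.2 (Nat.lt_succ_of_le this)

/-- `t` is an initial segment of the set `A`. -/
def IsFinsetInitialSegment (t : Finset ℕ) (A : Set ℕ) : Prop :=
  (t : Set ℕ) ⊆ A ∧ ∀ x ∈ A, ∀ y ∈ t, x ≤ y → x ∈ t

/-- `M` accepts `s` if `s`, continued by any infinite subset of `M`, has an initial segment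
in `F`. -/
def Accepts (F : Set (Finset ℕ)) (s : Finset ℕ) (M : Set ℕ) : Prop :=
  ∀ N ⊆ M, N.Infinite → (∀ n ∈ N, ∀ m ∈ s, m < n) →
    ∃ t ∈ F, IsFinsetInitialSegment t (s ∪ N)

theorem Accepts.mono {F : Set (Finset ℕ)} {s : Finset ℕ} {M N : Set ℕ} (h : Accepts F s M)
    (hNM : N ⊆ M) : Accepts F s N :=
  fun N' hN' => h N' (hN'.trans hNM)

/-- **Galvin's lemma**. -/
theorem exists_infinite_forall_not_subset_or_exists_initialSegment (F : Set (Finset ℕ)) :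
    ∃ L : Set ℕ, L.Infinite ∧ ((∀ t ∈ F, ¬ (t : Set ℕ) ⊆ L) ∨
      ∀ N ⊆ L, N.Infinite → ∃ t ∈ F, IsFinsetInitialSegment t N) := by
  obtain ⟨L, -, hL, hdec⟩ := exists_infinite_subset_forall_tail
    (D := fun s M => Accepts F s M ∨ ∀ N ⊆ M, N.Infinite → ¬ Accepts F s N)
    (fun s M N hNM h => h.imp (fun h => h.mono hNM) fun h N' hN' => h N' (hN'.trans hNM))
    (fun s M hM => by
      by_cases h : ∃ N ⊆ M, N.Infinite ∧ Accepts F s N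
      · obtain ⟨N, hNM, hN, h⟩ := h
        exact ⟨N, hNM, hN, Or.inl h⟩
      · push Not at h
        exact ⟨M, subset_rfl, hM, Or.inr h⟩) Set.infinite_univ
  let rej : Finset ℕ → Prop := fun s => ∀ N ⊆ L, N.Infinite → ¬ Accepts F s N
  -- The restriction to the tail past `s` can be dropped, as `Accepts` only tests continuations
  -- lying beyond `s`.
  have hdec' : ∀ s : Finset ℕ, (s : Set ℕ) ⊆ L → Accepts F s L ∨ rej s := by
    intro s hs
    refine (hdec s hs).imp (fun h N hN hNi hNs => ?_) fun h N hN hNi hacc => ?_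
    · exact h N (fun n hn => ⟨hN hn, hNs n hn⟩) hNi hNs
    · refine h {n ∈ N | ∀ m ∈ s, m < n} (fun n hn => ⟨hN hn.1, hn.2⟩) ?_
        (hacc.mono fun n hn => hn.1)
      refine (hNi.sdiff (Set.finite_Iic (s.sup id))).mono fun n hn => ⟨hn.1, fun m hm => ?_⟩
      exact (Finset.le_sup (f := id) hm).trans_lt (by simpa using hn.2)
  rcases hdec' ∅ (by simp) with h | h₀
  · refine ⟨L, hL, Or.inr fun N hN hNi => ?_⟩
    simpa using h N hN hNi (by simp)
  -- Second diagonalization: a rejected `s` has only finitely many accepted one-point extensions,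
  -- and these are discarded.
  obtain ⟨L', hL'L, hL', hD⟩ := exists_infinite_subset_forall_tail
    (D := fun s M => (s : Set ℕ) ⊆ L → rej s →
      ∀ n ∈ M, n ∈ L → (∀ m ∈ s, m < n) → rej (insert n s))
    (fun s M N hNM h hs hr n hn => h hs hr n (hNM hn))
    (fun s M hM => by
      by_cases hsr : (s : Set ℕ) ⊆ L ∧ rej s
      swap
      · exact ⟨M, subset_rfl, hM, fun h1 h2 => absurd ⟨h1, h2⟩ hsr⟩
      let B : Set ℕ := {n ∈ M | n ∈ L ∧ (∀ m ∈ s, m < n) ∧ ¬ rej (insert n s)}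
      have hB : B.Finite := by
        by_contra hB
        -- If infinite, the exceptional set would accept `s`: a continuation inside it starts with
        -- some `n`, and `insert n s` is already accepted.
        refine hsr.2 B (fun n hn => hn.2.1) hB fun N hN hNi hNs => ?_
        obtain ⟨n, hn, hmin⟩ : ∃ n ∈ N, ∀ x ∈ N, n ≤ x :=
          ⟨sInf N, Nat.sInf_mem hNi.nonempty, fun x hx => Nat.sInf_le hx⟩
        have hacc := (hdec' (insert n s) (by
          intro x hx
          rcases Finset.mem_insert.1 (Finset.mem_coe.1 hx) with rfl | hx
          · exact (hN hn).2.1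
          · exact hsr.1 hx)).resolve_right (hN hn).2.2.2
        obtain ⟨t, ht, hti⟩ := hacc (N \ {n}) (fun x hx => (hN hx.1).2.1)
          (hNi.sdiff (Set.finite_singleton n)) (by
            intro x hx m hm
            rcases Finset.mem_insert.1 hm with rfl | hm
            · exact lt_of_le_of_ne (hmin x hx.1) (fun h => hx.2 h.symm)
            · exact hNs x hx.1 m hm)
        refine ⟨t, ht, ?_⟩
        convert hti using 1
        ext x
        by_cases hx : x = n <;> simp [hx, hn]
      exact ⟨M \ B, Set.sdiff_subset, hM.sdiff hB, fun _ _ n hn hnL hns => by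
        by_contra h
        exact hn.2 ⟨hn.1, hnL, hns, h⟩⟩) hL
  refine ⟨L', hL', Or.inl ?_⟩
  have hrej : ∀ s : Finset ℕ, (s : Set ℕ) ⊆ L' → rej s := by
    intro s
    induction s using Finset.induction_on_max with
    | empty => exact fun _ => h₀
    | insert a s ha ih =>
      intro hs
      have hs' : (s : Set ℕ) ⊆ L' := fun x hx => hs (by simp [Finset.mem_coe.1 hx])
      have haL : a ∈ L' := hs (by simp)
      exact hD s hs' (hs'.trans hL'L) (ih hs') a ⟨haL, ha⟩ (hL'L haL) ha
  intro t ht htL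
  -- A member `t` of `F` is accepted by every set, being an initial segment of each of its own
  -- continuations.
  refine hrej t htL L subset_rfl hL fun N _ _ hNs => ⟨t, ht, Set.subset_union_left, ?_⟩
  rintro x (hx | hx) y hy hxy
  · exact hx
  · exact absurd (hNs x hx y hy) (not_lt.2 hxy)

/-- **Rosenthal's dichotomy** for a sequence of pairs of sets: some subsequence is either
independent, or no point belongs to infinitely many sets of both kinds. -/
theorem exists_strictMono_not_frequently_or_independent {α : Type*} (A B : ℕ → Set α) :
    (∃ φ : ℕ → ℕ, StrictMono φ ∧
      ∀ k, ¬ ((∃ᶠ n in atTop, k ∈ A (φ n)) ∧ ∃ᶠ n in atTop, k ∈ B (φ n))) ∨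
    ∃ φ : ℕ → ℕ, StrictMono φ ∧ ∀ (θ : ℕ → Prop) (n : ℕ),
      ∃ k, ∀ j < n, (θ j → k ∈ A (φ j)) ∧ (¬ θ j → k ∈ B (φ j)) := by
  classical
  -- The family consists of the finite sets x₀ < x₁ < ⋯ for which A x₀ ∩ B x₁ ∩ A x₂ ∩ ⋯ is empty.
  obtain ⟨L, hL, h⟩ := exists_infinite_forall_not_subset_or_exists_initialSegment
    {t : Finset ℕ | ¬ ∃ k, ∀ x ∈ t, (Even (t.filter (· < x)).card → k ∈ A x) ∧
      (¬ Even (t.filter (· < x)).card → k ∈ B x)}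
  have hl : StrictMono (Nat.nth (· ∈ L)) := Nat.nth_strictMono hL
  have hlL : ∀ n, Nat.nth (· ∈ L) n ∈ L := Nat.nth_mem_of_infinite hL
  generalize Nat.nth (· ∈ L) = l at hl hlL
  rcases h with h | h
  -- Only alternating patterns are available; the even-indexed points of `l` serve as fillers,
  -- inserted or not so that `l (2 * j + 1)` gets the parity that `θ j` demands.
  · refine Or.inr ⟨fun j => l (2 * j + 1), fun i j hij => hl (by omega), fun θ n => ?_⟩
    obtain ⟨s, hs, hsθ⟩ : ∃ s : Finset ℕ, (∀ x ∈ s, ∃ i < 2 * n, x = l i) ∧ ∀ j < n,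
        l (2 * j + 1) ∈ s ∧ (Even (s.filter (· < l (2 * j + 1))).card ↔ θ j) := by
      induction n with
      | zero => exact ⟨∅, by simp, by simp⟩
      | succ n ih =>
        obtain ⟨s, hs, hsθ⟩ := ih
        have hfil : ∀ x ∈ s, x < l (2 * n) := fun x hx => by
          obtain ⟨i, hi, rfl⟩ := hs x hx
          exact hl hi
        have hll : l (2 * n) < l (2 * n + 1) := hl (by omega)
        have key : ∃ r : Finset ℕ, s ⊆ r ∧ r ⊆ insert (l (2 * n)) s ∧ (Even r.card ↔ θ n) := by
          by_cases hp : Even s.card ↔ θ n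
          · exact ⟨s, subset_rfl, Finset.subset_insert _ _, hp⟩
          · refine ⟨insert (l (2 * n)) s, Finset.subset_insert _ _, subset_rfl, ?_⟩
            rw [Finset.card_insert_of_notMem fun h => (hfil _ h).ne rfl, Nat.even_add_one]
            tauto
        obtain ⟨r, hsr, hrs, hr⟩ := key
        have hrlt : ∀ x ∈ r, x < l (2 * n + 1) := fun x hx => by
          rcases Finset.mem_insert.1 (hrs hx) with rfl | hx
          · exact hll
          · exact (hfil x hx).trans hll
        refine ⟨insert (l (2 * n + 1)) r, ?_, ?_⟩
        · intro x hx
          rcases Finset.mem_insert.1 hx with rfl | hx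
          · exact ⟨_, by omega, rfl⟩
          rcases Finset.mem_insert.1 (hrs hx) with rfl | hx
          · exact ⟨_, by omega, rfl⟩
          · obtain ⟨i, hi, rfl⟩ := hs x hx
            exact ⟨i, by omega, rfl⟩
        · intro j hj
          rcases Nat.lt_succ_iff_lt_or_eq.1 hj with hj | rfl
          · refine ⟨Finset.mem_insert_of_mem (hsr (hsθ j hj).1), ?_⟩
            rw [← (hsθ j hj).2]
            have hj1 : l (2 * j + 1) < l (2 * n) := hl (by omega)
            have : (insert (l (2 * n + 1)) r).filter (· < l (2 * j + 1)) =
                s.filter (· < l (2 * j + 1)) := by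
              ext x
              simp only [Finset.mem_filter, Finset.mem_insert]
              constructor
              · rintro ⟨rfl | hx, hx'⟩
                · omega
                · rcases Finset.mem_insert.1 (hrs hx) with rfl | hx
                  · omega
                  · exact ⟨hx, hx'⟩
              · rintro ⟨hx, hx'⟩
                exact ⟨Or.inr (hsr hx), hx'⟩
            rw [this]
          · refine ⟨Finset.mem_insert_self _ _, ?_⟩
            rw [← hr]
            have : (insert (l (2 * j + 1)) r).filter (· < l (2 * j + 1)) = r := by
              ext x
              simp only [Finset.mem_filter, Finset.mem_insert]
              constructor
              · rintro ⟨rfl | hx, hx'⟩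
                · omega
                · exact hx
              · exact fun hx => ⟨Or.inr hx, hrlt x hx⟩
            rw [this]
    have hsF := fun hF => h s hF (by
      intro x hx
      obtain ⟨i, -, rfl⟩ := hs x hx
      exact hlL i)
    obtain ⟨k, hk⟩ := not_not.1 hsF
    refine ⟨k, fun j hj => ?_⟩
    obtain ⟨hmem, heven⟩ := hsθ j hj
    rw [← heven]
    exact hk _ hmem
  -- A point frequently in both kinds of sets realizes the alternating pattern along some
  -- subsequence, no initial segment of which can then lie in the family.
  · refine Or.inl ⟨l, hl, fun k hk => ?_⟩
    obtain ⟨g, hg, hgk⟩ := extraction_forall_of_frequently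
      (P := fun i n => (Even i → k ∈ A (l n)) ∧ (¬ Even i → k ∈ B (l n))) (fun i => by
        by_cases hi : Even i
        · simpa [hi] using hk.1
        · simpa [hi] using hk.2)
    have hlg : StrictMono (l ∘ g) := hl.comp hg
    obtain ⟨t, ht, htN⟩ := h (Set.range (l ∘ g)) (by rintro _ ⟨i, rfl⟩; exact hlL _)
      (Set.infinite_range_of_injective hlg.injective)
    refine ht ⟨k, fun x hx => ?_⟩
    obtain ⟨i, rfl⟩ := htN.1 hx
    have : t.filter (· < (l ∘ g) i) = (Finset.range i).map ⟨l ∘ g, hlg.injective⟩ := by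
      ext y
      simp only [Finset.mem_filter, Finset.mem_map, Finset.mem_range, Function.Embedding.coeFn_mk]
      constructor
      · rintro ⟨hy, hyi⟩
        obtain ⟨j, rfl⟩ := htN.1 hy
        exact ⟨j, hlg.lt_iff_lt.1 hyi, rfl⟩
      · rintro ⟨j, hj, rfl⟩
        exact ⟨htN.2 _ ⟨j, rfl⟩ _ hx (hlg hj).le, hlg hj⟩
    rw [this, Finset.card_map, Finset.card_range]
    exact hgk i

/-! ### Convex combinations of pointwise null sequences -/

/-- Convex combinations of a bounded sequence of continuous functions on a compact space which
tends to `0` pointwise are eventually uniformly small from above. -/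
theorem exists_convexCombination_lt_of_tendsto_zero {K : Type*} [TopologicalSpace K]
    [CompactSpace K] [T2Space K] (h : ℕ → C(K, ℝ)) (C : ℝ) (hC : ∀ j k, |h j k| ≤ C)
    (hlim : ∀ k, Tendsto (fun j => h j k) atTop (𝓝 0)) {η : ℝ} (hη : 0 < η) (N : ℕ) :
    ∃ a : ℕ →₀ ℝ, (∀ j ∈ a.support, N ≤ j) ∧ (∀ j, 0 ≤ a j) ∧ ∑ j ∈ a.support, a j = 1 ∧
      ∀ k, ∑ j ∈ a.support, a j * h j k < η := by
  classical
  let U : Set C(K, ℝ) := {g | ∀ k, g k < η}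
  have hUo : IsOpen U := by
    simpa [U, Set.MapsTo] using ContinuousMap.isOpen_setOfPred_mapsTo (X := K) isCompact_univ
      (isOpen_Iio (a := η))
  have hUc : Convex ℝ U := by
    intro f hf g hg s t hs ht hst k
    have h1 := hf k
    have h2 := hg k
    simp only [ContinuousMap.add_apply, ContinuousMap.smul_apply, smul_eq_mul]
    rcases hs.eq_or_lt with rfl | hs
    · have : t = 1 := by linarith
      simpa [this] using h2
    · nlinarith
  let S : Set (ℕ →₀ ℝ) := {a | (∀ j < N, a j = 0) ∧ (∀ j, 0 ≤ a j) ∧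
    Finsupp.linearCombination ℝ (fun _ : ℕ => (1 : ℝ)) a = 1}
  have hS : Convex ℝ S := by
    rintro a ⟨ha1, ha2, ha3⟩ b ⟨hb1, hb2, hb3⟩ s t hs ht hst
    refine ⟨fun j hj => by simp [ha1 j hj, hb1 j hj], fun j => ?_, ?_⟩
    · simp only [Finsupp.add_apply, Finsupp.smul_apply, smul_eq_mul]
      have := ha2 j
      have := hb2 j
      positivity
    · rw [map_add, map_smul, map_smul, ha3, hb3]
      simpa using hst
  by_cases hdisj : Disjoint U (Finsupp.linearCombination ℝ h '' S)
  swap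
  · obtain ⟨g, hgU, a, ⟨ha1, ha2, ha3⟩, rfl⟩ := Set.not_disjoint_iff.1 hdisj
    refine ⟨a, fun j hj => ?_, ha2, ?_, fun k => ?_⟩
    · by_contra hlt
      exact (Finsupp.mem_support_iff.1 hj) (ha1 j (not_le.1 hlt))
    · simpa [Finsupp.linearCombination_apply, Finsupp.sum] using ha3
    · have := hgU k
      simpa [Finsupp.linearCombination_apply, Finsupp.sum, ContinuousMap.sum_apply] using this
  · exfalso
    -- The separating functional turns out to be positive, hence a measure, and dominated
    -- convergence contradicts `u ≤ Λ (h j)` with `0 < u`.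
    obtain ⟨Λ, u, hΛU, hΛT⟩ := geometric_hahn_banach_open hUc hUo (hS.linear_image _) hdisj
    have hu : 0 < u := by
      have := hΛU 0 (fun k => by simpa using hη)
      simpa using this
    have hΛh : ∀ j, N ≤ j → u ≤ Λ (h j) := fun j hj => by
      refine hΛT _ ⟨Finsupp.single j 1, ⟨fun i hi => ?_, fun i => ?_, by simp⟩, by simp⟩
      · exact Finsupp.single_eq_of_ne (by omega)
      · by_cases hij : i = j
        · simp [hij]
        · simp [Finsupp.single_eq_of_ne hij]
    have hΛpos : ∀ g : C(K, ℝ), (∀ k, 0 ≤ g k) → 0 ≤ Λ g := by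
      intro g hg
      by_contra hneg
      -- This multiple of `g` is nonpositive, hence in `U`, but `Λ` takes there the value `u`
      -- itself.
      have h1 := hΛU ((u / Λ g) • g) (fun k => by
        have : u / Λ g ≤ 0 := div_nonpos_of_nonneg_of_nonpos hu.le (not_le.1 hneg).le
        have := mul_nonpos_of_nonpos_of_nonneg this (hg k)
        simp only [ContinuousMap.smul_apply, smul_eq_mul]
        linarith)
      rw [map_smul, smul_eq_mul, div_mul_cancel₀ _ (not_le.1 hneg).ne] at h1
      exact lt_irrefl _ h1
    let _ : MeasurableSpace K := borel K
    have : BorelSpace K := ⟨rfl⟩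
    let L : CompactlySupportedContinuousMap K ℝ →ₚ[ℝ] ℝ :=
      PositiveLinearMap.mk₀
        { toFun := fun g => Λ g.toContinuousMap
          map_add' := fun f g => map_add Λ f.toContinuousMap g.toContinuousMap
          map_smul' := fun c g => map_smul Λ c g.toContinuousMap }
        (fun g hg => hΛpos _ fun k => hg k)
    have hint : ∀ g : C(K, ℝ), ∫ k, g k ∂(RealRMK.rieszMeasure L) = Λ g := fun g =>
      RealRMK.integral_rieszMeasure L ⟨g, HasCompactSupport.of_compactSpace _⟩
    have ht : Tendsto (fun j => ∫ k, h j k ∂(RealRMK.rieszMeasure L)) atTop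
        (𝓝 (∫ _, (0 : ℝ) ∂(RealRMK.rieszMeasure L))) :=
      tendsto_integral_of_dominated_convergence (fun _ => C)
        (fun j => (h j).continuous.aestronglyMeasurable) (integrable_const _)
        (fun j => Eventually.of_forall fun k => hC j k) (Eventually.of_forall hlim)
    simp only [hint, integral_zero] at ht
    exact absurd (ge_of_tendsto ht (eventually_atTop.2 ⟨N, hΛh⟩)) (not_le.2 hu)

/-! ### Random signs -/

instance : DiscreteMeasurableSpace ℤˣ :=
  ⟨fun s => ⟨Units.val '' s, MeasurableSet.of_discrete,
    Set.preimage_image_eq s Units.val_injective⟩⟩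

instance : IsProbabilityMeasure signMeasure := by
  unfold signMeasure
  infer_instance

/-- The cylinder of the sign sequences with prescribed values on a finite set. -/
def signCylinder (S : Finset ℕ) (θ : ℕ → ℤˣ) : Set (ℕ → ℤˣ) := {ε | ∀ i ∈ S, ε i = θ i}

theorem measurableSet_signCylinder (S : Finset ℕ) (θ : ℕ → ℤˣ) :
    MeasurableSet (signCylinder S θ) := by
  have : signCylinder S θ = ⋂ i ∈ S, (fun ε : ℕ → ℤˣ => ε i) ⁻¹' {θ i} := by
    ext ε
    simp [signCylinder]
  rw [this]
  exact Finset.measurableSet_biInter _ fun i _ =>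
    measurable_pi_apply i (measurableSet_singleton _)

theorem uniformSign_singleton (e : ℤˣ) :
    (PMF.uniformOfFintype ℤˣ).toMeasure {e} = (2 : ENNReal)⁻¹ := by
  rw [PMF.toMeasure_apply_singleton _ _ (measurableSet_singleton _), PMF.uniformOfFintype_apply]
  simp

theorem signMeasure_signCylinder (S : Finset ℕ) (θ : ℕ → ℤˣ) :
    signMeasure (signCylinder S θ) = (2 : ENNReal)⁻¹ ^ S.card := by
  have : signCylinder S θ = Set.pi (S : Set ℕ) fun i => {θ i} := by
    ext ε
    simp [signCylinder, Set.pi]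
  rw [this, signMeasure, Measure.infinitePi_pi _ fun i _ => measurableSet_singleton _]
  simp only [uniformSign_singleton, Finset.prod_const]

theorem measurePreserving_sign_mul (τ : ℕ → ℤˣ) :
    MeasurePreserving (fun ε => τ * ε) signMeasure signMeasure := by
  refine ⟨by fun_prop, ?_⟩
  unfold signMeasure
  refine (Measure.infinitePi_map_pi (f := fun i e => τ i * e) _
    fun i => Measurable.of_discrete).trans ?_
  congr 1
  ext1 i
  refine Measure.ext_of_singleton fun e => ?_
  rw [Measure.map_apply Measurable.of_discrete (measurableSet_singleton _)]
  have : (fun e' => τ i * e') ⁻¹' {e} = {τ i * e} := by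
    ext e'
    constructor
    · rintro rfl
      simp [← mul_assoc]
    · rintro rfl
      simp
  rw [this, uniformSign_singleton, uniformSign_singleton]

/-- Multiplication by `τ` is a measurable equivalence, so `f` may be arbitrary. -/
theorem integral_sign_mul_comp (τ : ℕ → ℤˣ) (f : (ℕ → ℤˣ) → ℝ) :
    ∫ ε, f (τ * ε) ∂signMeasure = ∫ ε, f ε ∂signMeasure := by
  have hm : MeasurableEmbedding fun ε : ℕ → ℤˣ => τ * ε :=
    (MeasurableEquiv.mk (Equiv.mulLeft τ) (by simp only [Equiv.coe_mulLeft]; fun_prop)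
      (by simp only [Equiv.mulLeft_symm, Equiv.coe_mulLeft]; fun_prop)).measurableEmbedding
  exact (measurePreserving_sign_mul τ).integral_comp hm f

theorem measurable_sign (i : ℕ) : Measurable fun ε : ℕ → ℤˣ => ((ε i : ℤ) : ℝ) :=
  (Measurable.of_discrete (f := fun e : ℤˣ => ((e : ℤ) : ℝ))).comp (measurable_pi_apply i)

theorem abs_sign (e : ℤˣ) : |((e : ℤ) : ℝ)| = 1 := by
  rcases Int.units_eq_one_or e with rfl | rfl <;> simp

theorem sign_cast_mul_self (e : ℤˣ) : ((e : ℤ) : ℝ) * ((e : ℤ) : ℝ) = 1 := by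
  rcases Int.units_eq_one_or e with rfl | rfl <;> simp

theorem integrable_of_abs_le {f : (ℕ → ℤˣ) → ℝ} (hf : Measurable f) (C : ℝ)
    (hC : ∀ ε, |f ε| ≤ C) : Integrable f signMeasure :=
  Integrable.of_bound hf.aestronglyMeasurable C (Eventually.of_forall hC)

theorem abs_sum_sign_le (F : Finset ℕ) (c : ℕ → ℝ) (ε : ℕ → ℤˣ) :
    |∑ i ∈ F, c i * ((ε i : ℤ) : ℝ)| ≤ ∑ i ∈ F, |c i| := by
  refine (Finset.abs_sum_le_sum_abs _ _).trans (Finset.sum_le_sum fun i _ => ?_)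
  rw [abs_mul, abs_sign, mul_one]

theorem integral_sign_mul_sign {i j : ℕ} (hij : i ≠ j) :
    ∫ ε, ((ε i : ℤ) : ℝ) * ((ε j : ℤ) : ℝ) ∂signMeasure = 0 := by
  -- Reversing the `i`-th sign alone negates the integrand and preserves the integral.
  have h := integral_sign_mul_comp (Function.update 1 i (-1))
    fun ε => ((ε i : ℤ) : ℝ) * ((ε j : ℤ) : ℝ)
  simp only [Pi.mul_apply, Function.update_self, Function.update_of_ne hij.symm, Pi.one_apply,
    one_mul, Units.val_neg, neg_mul, Int.cast_neg,
    integral_neg] at h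
  linarith

theorem integral_sum_sign_sq (F : Finset ℕ) (c : ℕ → ℝ) :
    ∫ ε, (∑ i ∈ F, c i * ((ε i : ℤ) : ℝ)) ^ 2 ∂signMeasure = ∑ i ∈ F, c i ^ 2 := by
  have hmeas : ∀ i j, Integrable (fun ε : ℕ → ℤˣ => c i * c j *
      (((ε i : ℤ) : ℝ) * ((ε j : ℤ) : ℝ))) signMeasure := fun i j =>
    integrable_of_abs_le (((measurable_sign i).mul (measurable_sign j)).const_mul _)
      |c i * c j| fun ε => by rw [abs_mul, abs_mul (((ε i : ℤ) : ℝ)), abs_sign, abs_sign]; simp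
  have h1 : ∀ ε : ℕ → ℤˣ, (∑ i ∈ F, c i * ((ε i : ℤ) : ℝ)) ^ 2 =
      ∑ i ∈ F, ∑ j ∈ F, c i * c j * (((ε i : ℤ) : ℝ) * ((ε j : ℤ) : ℝ)) := fun ε => by
    rw [sq, Finset.sum_mul_sum]
    exact Finset.sum_congr rfl fun i _ => Finset.sum_congr rfl fun j _ => by ring
  simp only [h1]
  rw [integral_finsetSum _ fun i _ => integrable_finsetSum _ fun j _ => hmeas i j]
  refine Finset.sum_congr rfl fun i hi => ?_
  rw [integral_finsetSum _ fun j _ => hmeas i j, Finset.sum_eq_single i]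
  · simp [sign_cast_mul_self, sq]
  · intro j _ hj
    rw [integral_const_mul, integral_sign_mul_sign hj.symm, mul_zero]
  · exact fun h => absurd hi h

/-- The easy half of Khinchine's inequality. -/
theorem integral_abs_sum_sign_le (F : Finset ℕ) (c : ℕ → ℝ) :
    ∫ ε, |∑ i ∈ F, c i * ((ε i : ℤ) : ℝ)| ∂signMeasure ≤ √(∑ i ∈ F, c i ^ 2) := by
  set s := √(∑ i ∈ F, c i ^ 2)
  have hs : s ^ 2 = ∑ i ∈ F, c i ^ 2 := Real.sq_sqrt (Finset.sum_nonneg fun i _ => sq_nonneg _)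
  have hmeas : Measurable fun ε : ℕ → ℤˣ => ∑ i ∈ F, c i * ((ε i : ℤ) : ℝ) :=
    Finset.measurable_sum _ fun i _ => (measurable_sign i).const_mul _
  have hi1 : Integrable (fun ε : ℕ → ℤˣ => |∑ i ∈ F, c i * ((ε i : ℤ) : ℝ)|) signMeasure :=
    integrable_of_abs_le hmeas.abs _ fun ε => by rw [abs_abs]; exact abs_sum_sign_le F c ε
  have hi2 : Integrable (fun ε : ℕ → ℤˣ => (∑ i ∈ F, c i * ((ε i : ℤ) : ℝ)) ^ 2) signMeasure :=
    integrable_of_abs_le (hmeas.pow_const 2) ((∑ i ∈ F, |c i|) ^ 2) fun ε => by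
      rw [abs_pow]
      exact pow_le_pow_left₀ (abs_nonneg _) (abs_sum_sign_le F c ε) 2
  have hs0 : 0 ≤ s := Real.sqrt_nonneg _
  clear_value s
  rcases hs0.eq_or_lt with h0 | hpos
  · have hz : ∀ i ∈ F, c i = 0 := by
      rw [← h0, zero_pow two_ne_zero] at hs
      exact fun i hi => pow_eq_zero_iff two_ne_zero |>.1
        ((Finset.sum_eq_zero_iff_of_nonneg fun i _ => sq_nonneg _).1 hs.symm i hi)
    rw [← h0]
    refine (integral_eq_zero_of_ae (Eventually.of_forall fun ε => ?_)).le
    simp only [Pi.zero_apply, abs_eq_zero]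
    exact Finset.sum_eq_zero fun i hi => by rw [hz i hi, zero_mul]
  -- Pointwise y ≤ y² / (2s) + s / 2, from (y - s)² ≥ 0; the second moment being s², the right side
  -- integrates to s.
  · calc ∫ ε, |∑ i ∈ F, c i * ((ε i : ℤ) : ℝ)| ∂signMeasure
        ≤ ∫ ε, ((2 * s)⁻¹ * (∑ i ∈ F, c i * ((ε i : ℤ) : ℝ)) ^ 2 + s / 2) ∂signMeasure := by
          refine integral_mono hi1 ((hi2.const_mul _).add (integrable_const _)) fun ε => ?_
          simp only
          rw [← sq_abs (∑ i ∈ F, c i * ((ε i : ℤ) : ℝ))]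
          generalize |∑ i ∈ F, c i * ((ε i : ℤ) : ℝ)| = y
          have : (2 * s)⁻¹ * y ^ 2 + s / 2 - y = (2 * s)⁻¹ * (y - s) ^ 2 := by
            field_simp
            ring
          have : 0 ≤ (2 * s)⁻¹ * (y - s) ^ 2 := by positivity
          linarith
      _ = s := by
          rw [integral_add (hi2.const_mul _) (integrable_const _), integral_const_mul,
            integral_sum_sign_sq, ← hs]
          simp
          field_simp
          ring

/-- The Rademacher functions tend weakly to `0`. -/
theorem tendsto_setIntegral_sign {B : Set (ℕ → ℤˣ)} :
    Tendsto (fun n => ∫ ε in B, ((ε n : ℤ) : ℝ) ∂signMeasure) atTop (𝓝 0) := by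
  set c : ℕ → ℝ := fun n => ∫ ε in B, ((ε n : ℤ) : ℝ) ∂signMeasure
  rw [Metric.tendsto_atTop]
  by_contra! hcon
  obtain ⟨γ, hγ, hcon⟩ := hcon
  have hinf : {n | γ ≤ |c n|}.Infinite := by
    refine Set.infinite_of_not_bddAbove fun ⟨N, hN⟩ => ?_
    obtain ⟨n, hn, hcn⟩ := hcon (N + 1)
    have := hN (show n ∈ {n | γ ≤ |c n|} by simpa using hcn)
    omega
  -- A set of m coordinates with γ ≤ |c n| forces mγ ≤ √m by Khinchine, impossible once m > γ⁻².
  obtain ⟨m, hm⟩ := exists_nat_gt (γ⁻¹ ^ 2)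
  obtain ⟨F, hF, hFc⟩ := hinf.exists_subset_card_eq m
  let s : ℕ → ℝ := fun n => if 0 ≤ c n then 1 else -1
  have hs : ∀ n, s n ^ 2 = 1 := fun n => by
    simp only [s]
    split_ifs <;> norm_num
  have hsc : ∀ n, s n * c n = |c n| := fun n => by
    simp only [s]
    split_ifs with h
    · rw [abs_of_nonneg h, one_mul]
    · rw [abs_of_neg (not_le.1 h), neg_one_mul]
  have hmeas : Measurable fun ε : ℕ → ℤˣ => ∑ i ∈ F, s i * ((ε i : ℤ) : ℝ) :=
    Finset.measurable_sum _ fun i _ => (measurable_sign i).const_mul _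
  have hint : Integrable (fun ε : ℕ → ℤˣ => ∑ i ∈ F, s i * ((ε i : ℤ) : ℝ)) signMeasure :=
    integrable_of_abs_le hmeas _ (abs_sum_sign_le F s)
  have hle : m * γ ≤ √m := by
    calc m * γ = ∑ _n ∈ F, γ := by simp [hFc]
      _ ≤ ∑ n ∈ F, s n * c n := Finset.sum_le_sum fun n hn => by
          rw [hsc]
          exact hF hn
      _ = ∫ ε in B, ∑ i ∈ F, s i * ((ε i : ℤ) : ℝ) ∂signMeasure := by
          rw [integral_finsetSum]
          · exact Finset.sum_congr rfl fun n _ => (integral_const_mul _ _).symm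
          · exact fun i _ => (integrable_of_abs_le ((measurable_sign i).const_mul _) |s i|
              fun ε => by rw [abs_mul, abs_sign, mul_one]).integrableOn
      _ ≤ ∫ ε in B, |∑ i ∈ F, s i * ((ε i : ℤ) : ℝ)| ∂signMeasure :=
          integral_mono hint.integrableOn hint.abs.integrableOn fun ε => le_abs_self _
      _ ≤ ∫ ε, |∑ i ∈ F, s i * ((ε i : ℤ) : ℝ)| ∂signMeasure :=
          setIntegral_le_integral hint.abs (Eventually.of_forall fun ε => abs_nonneg _)
      _ ≤ √(∑ i ∈ F, s i ^ 2) := integral_abs_sum_sign_le F s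
      _ = √m := by simp [hs, hFc]
  have hm0 : (0 : ℝ) < m := lt_of_le_of_lt (by positivity) hm
  have h1 : m * γ ^ 2 ≤ 1 := by
    have h2 : (m * γ) ^ 2 ≤ m := by
      rw [← Real.sq_sqrt hm0.le]
      exact pow_le_pow_left₀ (by positivity) (by rwa [Real.sq_sqrt hm0.le]) 2
    have : m * (m * γ ^ 2) ≤ m * 1 := by linarith
    exact le_of_mul_le_mul_left this hm0
  have h3 : γ⁻¹ ^ 2 * γ ^ 2 < m * γ ^ 2 := by gcongr
  rw [← mul_pow, inv_mul_cancel₀ hγ.ne'] at h3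
  linarith

/-- The indicator of `ε n = e` is (1 + e ε_n) / 2, and the Rademacher term disappears in the limit:
far coordinates split any fixed set evenly. -/
theorem tendsto_measureReal_inter_sign_eq (B : Set (ℕ → ℤˣ)) (e : ℤˣ) :
    Tendsto (fun n => signMeasure.real (B ∩ {ε | ε n = e})) atTop
      (𝓝 (signMeasure.real B / 2)) := by
  have hlim := ((tendsto_setIntegral_sign (B := B)).const_mul (((e : ℤ) : ℝ) / 2)).const_add
    (signMeasure.real B / 2)
  rw [mul_zero, add_zero] at hlim
  refine hlim.congr fun n => ?_
  have hE : MeasurableSet {ε : ℕ → ℤˣ | ε n = e} :=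
    (measurable_pi_apply n : Measurable fun ε : ℕ → ℤˣ => ε n) (measurableSet_singleton e)
  have h1 : ∀ ε : ℕ → ℤˣ, Set.indicator {ε : ℕ → ℤˣ | ε n = e} (fun _ => (1 : ℝ)) ε =
      1 / 2 + ((e : ℤ) : ℝ) / 2 * ((ε n : ℤ) : ℝ) := fun ε => by
    rcases Int.units_eq_one_or e with rfl | rfl <;>
      rcases Int.units_eq_one_or (ε n) with h | h <;> simp [Set.indicator, h] <;> norm_num
  have hint : Integrable (fun ε : ℕ → ℤˣ => ((ε n : ℤ) : ℝ)) (signMeasure.restrict B) :=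
    (integrable_of_abs_le (measurable_sign n) 1 fun ε => (abs_sign _).le).integrableOn
  have h2 : ∫ ε in B, Set.indicator {ε : ℕ → ℤˣ | ε n = e} (fun _ => (1 : ℝ)) ε ∂signMeasure =
      signMeasure.real (B ∩ {ε | ε n = e}) := by
    rw [setIntegral_indicator hE]
    simp
  rw [← h2]
  simp only [h1]
  rw [integral_add (integrable_const _) (hint.const_mul _), integral_const_mul]
  simp
  ring

/-- A set of sign sequences of measure larger than `1/2` meets its reflections: along some
subsequence, the first coordinates can be prescribed and the signs of all others reversed without
leaving the set. -/
theorem exists_strictMono_forall_exists_reflection {A : Set (ℕ → ℤˣ)} (hA : MeasurableSet A)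
    (hhalf : 1 / 2 < signMeasure.real A) :
    ∃ φ : ℕ → ℕ, StrictMono φ ∧ ∀ (k : ℕ) (θ : ℕ → ℤˣ), ∃ ε ∈ A,
      (∀ i < k, ε (φ i) = θ i) ∧
      (fun n => if n ∈ (Finset.range k).image φ then ε n else -ε n) ∈ A := by
  -- Invariant: `A` fills more than half of every cylinder over `S`. There are finitely many
  -- patterns on `S`, so one far coordinate splits all these intersections evenly enough to preserve
  -- it.
  let Q : Finset ℕ → Prop := fun S =>
    ∀ θ, (2 : ℝ)⁻¹ ^ S.card / 2 < signMeasure.real (A ∩ signCylinder S θ)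
  have hQ0 : Q ∅ := fun θ => by simpa [signCylinder] using hhalf
  have hstep : ∀ S : {S // Q S}, ∃ n, (∀ m ∈ S.1, m < n) ∧ Q (insert n S.1) := by
    rintro ⟨S, hS⟩
    let ext : (S → ℤˣ) → ℕ → ℤˣ := fun ϑ i => if h : i ∈ S then ϑ ⟨i, h⟩ else 1
    have hev : ∀ᶠ n in atTop, ∀ (ϑ : S → ℤˣ) (e : ℤˣ), (2 : ℝ)⁻¹ ^ S.card / 2 / 2 <
        signMeasure.real (A ∩ signCylinder S (ext ϑ) ∩ {ε | ε n = e}) := by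
      rw [eventually_all]
      intro ϑ
      rw [eventually_all]
      intro e
      refine (tendsto_measureReal_inter_sign_eq
        (A ∩ signCylinder S (ext ϑ)) e).eventually_const_lt ?_
      have := hS (ext ϑ)
      linarith
    obtain ⟨n, hn, hnS⟩ := (hev.and (eventually_gt_atTop (S.sup id))).exists
    have hlt : ∀ m ∈ S, m < n := fun m hm => (Finset.le_sup (f := id) hm).trans_lt hnS
    refine ⟨n, hlt, fun θ => ?_⟩
    have hcyl : A ∩ signCylinder (insert n S) θ =
        A ∩ signCylinder S (ext fun i => θ i) ∩ {ε | ε n = θ n} := by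
      ext ε
      have : (∀ i ∈ S, ε i = ext (fun i => θ i) i) ↔ ∀ i ∈ S, ε i = θ i :=
        forall₂_congr fun i hi => by simp [ext, hi]
      simp only [signCylinder, Set.mem_inter_iff, Set.mem_ofPred_eq, Finset.forall_mem_insert, this]
      tauto
    rw [hcyl, Finset.card_insert_of_notMem fun h => (hlt n h).ne rfl, pow_succ]
    have := hn (fun i => θ i) (θ n)
    linarith
  choose nxt hlt hQ using hstep
  let seq : ℕ → {S // Q S} := fun k => (fun S => ⟨insert (nxt S) S.1, hQ S⟩)^[k] ⟨∅, hQ0⟩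
  have hseq : ∀ k, (seq (k + 1)).1 = insert (nxt (seq k)) (seq k).1 := fun k => by
    simp only [seq, Function.iterate_succ_apply']
  let φ : ℕ → ℕ := fun k => nxt (seq k)
  have himg : ∀ k, (seq k).1 = (Finset.range k).image φ := by
    intro k
    induction k with
    | zero => simp [seq]
    | succ k ih => rw [hseq, Finset.range_add_one, Finset.image_insert, ih]
  have hφ : StrictMono φ := strictMono_nat_of_lt_succ fun k =>
    hlt (seq (k + 1)) _ (by rw [hseq]; exact Finset.mem_insert_self _ _)
  refine ⟨φ, hφ, fun k θ => ?_⟩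
  set S := (Finset.range k).image φ with hSdef
  have hS : Q S := by
    rw [hSdef, ← himg k]
    exact (seq k).2
  have hcard : S.card = k := by
    rw [hSdef, Finset.card_image_of_injective _ hφ.injective, Finset.card_range]
  obtain ⟨θ', hθ'⟩ : ∃ θ' : ℕ → ℤˣ, ∀ i, θ' (φ i) = θ i :=
    ⟨Function.extend φ θ 1, fun i => hφ.injective.extend_apply _ _ _⟩
  -- Reversing all signs outside `S` preserves both the cylinder and the measure, so `A` and its
  -- reflection each fill more than half of the cylinder and must meet there.
  let τ : ℕ → ℤˣ := fun n => if n ∈ S then 1 else -1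
  have hτC : (fun ε => τ * ε) ⁻¹' (A ∩ signCylinder S θ') =
      (fun ε => τ * ε) ⁻¹' A ∩ signCylinder S θ' := by
    ext ε
    simp only [Set.mem_preimage, Set.mem_inter_iff, signCylinder, Set.mem_ofPred_eq]
    refine and_congr_right fun _ => forall₂_congr fun i hi => ?_
    simp [τ, hi]
  have hmeas := hA.inter (measurableSet_signCylinder S θ')
  have hm1 : signMeasure ((fun ε => τ * ε) ⁻¹' A ∩ signCylinder S θ') =
      signMeasure (A ∩ signCylinder S θ') := by
    rw [← hτC]
    exact (measurePreserving_sign_mul τ).measure_preimage hmeas.nullMeasurableSet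
  have hsum : signMeasure (signCylinder S θ') <
      signMeasure ((fun ε => τ * ε) ⁻¹' A ∩ signCylinder S θ') +
        signMeasure (A ∩ signCylinder S θ') := by
    rw [hm1, ← two_mul, signMeasure_signCylinder]
    have h1 := hS θ'
    rw [← ENNReal.toReal_lt_toReal (by simp) (by finiteness)]
    simp only [ENNReal.toReal_pow, ENNReal.toReal_inv, ENNReal.toReal_ofNat, ENNReal.toReal_mul]
    rw [Measure.real] at h1
    linarith
  obtain ⟨ε, ⟨hε1, hε2⟩, hε3, -⟩ := nonempty_inter_of_measure_lt_add signMeasure hmeas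
    (Set.inter_subset_right) (Set.inter_subset_right) hsum
  refine ⟨ε, hε3, fun i hi => ?_, ?_⟩
  · rw [← hθ']
    exact hε2 _ (Finset.mem_image_of_mem φ (Finset.mem_range.2 hi))
  · have : (fun n => if n ∈ S then ε n else -ε n) = τ * ε := by
      ext1 n
      by_cases hn : n ∈ S <;> simp [τ, hn]
    rw [this]
    exact hε1

/-- Each term factors through one sign and takes at most two values, so `X` need not be separable.
-/
theorem stronglyMeasurable_sum_sign_smul {X : Type*} [NormedAddCommGroup X] (F : Finset ℕ)
    (y : ℕ → X) : StronglyMeasurable fun ε : ℕ → ℤˣ => ∑ i ∈ F, ε i • y i :=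
  Finset.stronglyMeasurable_fun_sum F fun i _ =>
    (StronglyMeasurable.of_discrete (f := fun e : ℤˣ => e • y i)).comp_measurable
      (measurable_pi_apply i)

/-! ### Blocks of a Schauder basis -/

section Blocks

/-- Serves to define coefficients and weights block by block, `Nat.findGreatest` being the index of
the block around `j`. -/
theorem Nat.findGreatest_eq_of_mem_Ico {q : ℕ → ℕ} (hq : StrictMono q) {k j : ℕ} (h1 : q k ≤ j)
    (h2 : j < q (k + 1)) : Nat.findGreatest (fun i => q i ≤ j) j = k := by
  rw [Nat.findGreatest_eq_iff]
  refine ⟨(hq.id_le k).trans h1, fun _ => h1, fun n hn _ h => ?_⟩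
  exact absurd ((hq.monotone (Nat.succ_le_of_lt hn)).trans h) (not_le.2 h2)

theorem sum_range_sum_Ico_eq {M : Type*} [AddCommMonoid M] {p : ℕ → ℕ} (hp : Monotone p)
    (f : ℕ → M) (n : ℕ) :
    ∑ j ∈ Finset.range n, ∑ i ∈ Finset.Ico (p j) (p (j + 1)), f i =
      ∑ i ∈ Finset.Ico (p 0) (p n), f i := by
  induction n with
  | zero => simp
  | succ n ih =>
    rw [Finset.sum_range_succ, ih, Finset.sum_Ico_consecutive _ (hp (Nat.zero_le n))
      (hp n.le_succ)]

variable {𝕜 : Type*} [RCLike 𝕜] {X : Type*} [NormedAddCommGroup X] [NormedSpace 𝕜 X]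

namespace SchauderBasis

variable (x : SchauderBasis 𝕜 X)

theorem proj_sum_Ico (a : ℕ → 𝕜) (l m n : ℕ) :
    proj x n (∑ i ∈ Finset.Ico l m, a i • x i) = ∑ i ∈ Finset.Ico l (min m n), a i • x i := by
  simp only [map_sum, map_smul, proj_apply_basis_mem]
  simp only [smul_ite, smul_zero]
  rw [← Finset.sum_filter]
  congr 1
  ext i
  simp only [Finset.mem_filter, Finset.mem_Ico]
  omega

theorem proj_block {p : ℕ → ℕ} (hp : Monotone p) {a : ℕ → 𝕜} {u : ℕ → X}
    (hu : ∀ j, u j = ∑ n ∈ Finset.Ico (p j) (p (j + 1)), a n • x n) (n j : ℕ) :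
    proj x (p n) (u j) = if j < n then u j else 0 := by
  rw [hu, proj_sum_Ico]
  split_ifs with h
  · rw [min_eq_left (hp (Nat.succ_le_of_lt h))]
  · rw [Finset.Ico_eq_empty, Finset.sum_empty]
    have := hp (not_lt.1 h)
    have := min_le_right (p (j + 1)) (p n)
    omega

/-- Vectors with consecutive supports have a common sequence of coefficients. -/
theorem exists_coeff_of_proj_sub {p : ℕ → ℕ} (hp : StrictMono p) (w : ℕ → X) :
    ∃ a : ℕ → 𝕜, ∀ j, proj x (p (j + 1)) (w j) - proj x (p j) (w j) =
      ∑ n ∈ Finset.Ico (p j) (p (j + 1)), a n • x n := by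
  refine ⟨fun n => x.coord n (w (Nat.findGreatest (fun i => p i ≤ n) n)), fun j => ?_⟩
  rw [proj_apply, proj_apply, ← Finset.sum_Ico_eq_sub _ (hp.monotone j.le_succ)]
  refine Finset.sum_congr rfl fun n hn => ?_
  rw [Finset.mem_Ico] at hn
  simp only [Nat.findGreatest_eq_of_mem_Ico hp hn.1 hn.2]

theorem exists_proj_bound [CompleteSpace X] :
    ∃ C : ℝ, 1 ≤ C ∧ ∀ (n : ℕ) (y : X), ‖proj x n y‖ ≤ C * ‖y‖ := by
  obtain ⟨C, hC⟩ := exists_norm_proj_le x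
  refine ⟨max C 1, le_max_right _ _, fun n y => ((proj x n).le_opNorm y).trans ?_⟩
  gcongr
  exact (hC n).trans (le_max_left _ _)

end SchauderBasis

end Blocks

/-! ### Estimates producing copies of ℓ₁ and c₀ -/

theorem RCLike.norm_le_abs_re_add_abs_im {𝕜 : Type*} [RCLike 𝕜] (z : 𝕜) :
    ‖z‖ ≤ |RCLike.re z| + |RCLike.im z| := by
  conv_lhs => rw [← RCLike.re_add_im z]
  refine (norm_add_le _ _).trans ?_
  rw [norm_mul, RCLike.norm_ofReal, RCLike.norm_ofReal]
  gcongr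
  refine mul_le_of_le_one_right (abs_nonneg _) ?_
  rw [RCLike.norm_I]
  split_ifs <;> norm_num

section Copies

variable {𝕜 : Type*} [RCLike 𝕜] {X : Type*} [NormedAddCommGroup X] [NormedSpace 𝕜 X]

/-- The lower bound makes `T` injective with closed range, and the open mapping theorem inverts it
there. -/
theorem containsIsomorphicCopy_of_bound [CompleteSpace X] {E : Type*} [NormedAddCommGroup E] [NormedSpace 𝕜 E]
    [CompleteSpace E] (T : E →L[𝕜] X) {κ : ℝ} (hκ : 0 < κ) (hT : ∀ e, κ * ‖e‖ ≤ ‖T e‖) :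
    ContainsIsomorphicCopy 𝕜 X E := by
  have hanti : AntilipschitzWith (κ⁻¹).toNNReal T := by
    refine T.antilipschitz_of_bound fun e => ?_
    rw [Real.coe_toNNReal _ (inv_nonneg.2 hκ.le), ← div_eq_inv_mul, le_div_iff₀ hκ, mul_comm]
    exact hT e
  exact ⟨_, ⟨(T.equivRange hanti.injective
    (hanti.isClosed_range T.uniformContinuous)).symm⟩⟩

/-- Boundedness of `v` makes c ↦ ∑ c i • v i absolutely convergent and bounded; the lower estimate
survives the limit of finite sums. -/
theorem containsIsomorphicCopy_lp_one [CompleteSpace X] {v : ℕ → X} {C κ : ℝ} (hC : ∀ n, ‖v n‖ ≤ C) (hκ : 0 < κ)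
    (hv : ∀ (n : ℕ) (c : ℕ → 𝕜),
      κ * ∑ i ∈ Finset.range n, ‖c i‖ ≤ ‖∑ i ∈ Finset.range n, c i • v i‖) :
    ContainsIsomorphicCopy 𝕜 X (lp (fun _ : ℕ => 𝕜) 1) := by
  have hnorm : ∀ c : lp (fun _ : ℕ => 𝕜) 1, HasSum (fun i => ‖c i‖) ‖c‖ := fun c => by
    simpa using lp.hasSum_norm (p := 1) (by simp) c
  have hsum : ∀ c : lp (fun _ : ℕ => 𝕜) 1, Summable fun i => c i • v i := fun c =>
    Summable.of_norm_bounded ((hnorm c).summable.mul_right C) fun i => by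
      rw [norm_smul]
      exact mul_le_mul_of_nonneg_left (hC i) (norm_nonneg _)
  let T : lp (fun _ : ℕ => 𝕜) 1 →ₗ[𝕜] X :=
    { toFun := fun c => ∑' i, c i • v i
      map_add' := fun c d => by
        simp only [lp.coeFn_add, Pi.add_apply, add_smul]
        exact (hsum c).tsum_add (hsum d)
      map_smul' := fun r c => by
        simp only [lp.coeFn_smul, Pi.smul_apply, smul_assoc, RingHom.id_apply]
        exact (hsum c).tsum_const_smul r }
  have hT : ∀ c, ‖T c‖ ≤ C * ‖c‖ := fun c => by
    refine tsum_of_norm_bounded ((hnorm c).mul_left C) fun i => ?_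
    rw [norm_smul, mul_comm]
    exact mul_le_mul_of_nonneg_right (hC i) (norm_nonneg _)
  refine containsIsomorphicCopy_of_bound (T.mkContinuous C hT) hκ fun c => ?_
  exact le_of_tendsto_of_tendsto' ((hnorm c).tendsto_sum_nat.const_mul κ)
    (hsum c).hasSum.tendsto_sum_nat.norm fun n => hv n c

/-- Bounds for all sums with signs give bounds for all sums with scalar coefficients. -/
theorem norm_sum_smul_le_of_signs {v : ℕ → X} {M : ℝ}
    (hM : ∀ (k : ℕ) (θ : ℕ → ℤˣ), ‖∑ i ∈ Finset.range k, θ i • v i‖ ≤ M)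
    (F : Finset ℕ) (c : ℕ → 𝕜) {r : ℝ} (hr : 0 ≤ r) (hc : ∀ i ∈ F, ‖c i‖ ≤ r) :
    ‖∑ i ∈ F, c i • v i‖ ≤ 2 * M * r := by
  obtain ⟨k, hk⟩ : ∃ k, F ⊆ Finset.range k := ⟨_, F.subset_range_sup_succ⟩
  obtain ⟨g, hg, hgv⟩ := exists_dual_vector'' 𝕜 (∑ i ∈ F, c i • v i)
  -- Applied to the real and the imaginary part, which together account for the factor 2.
  have hsign : ∀ φ : 𝕜 →ₗ[ℝ] ℝ, (∀ z, |φ z| ≤ ‖z‖) →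
      ∑ i ∈ Finset.range k, |φ (g (v i))| ≤ M := by
    intro φ hφ
    let θ : ℕ → ℤˣ := fun i => if 0 ≤ φ (g (v i)) then 1 else -1
    have hθ : ∀ i, |φ (g (v i))| = φ (g (θ i • v i)) := fun i => by
      simp only [θ]
      split_ifs with h
      · simp [abs_of_nonneg h]
      · simp [abs_of_neg (not_le.1 h), Units.smul_def]
    calc ∑ i ∈ Finset.range k, |φ (g (v i))|
        = φ (g (∑ i ∈ Finset.range k, θ i • v i)) := by
          rw [map_sum, map_sum]
          exact Finset.sum_congr rfl fun i _ => hθ i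
      _ ≤ ‖g (∑ i ∈ Finset.range k, θ i • v i)‖ := (le_abs_self _).trans (hφ _)
      _ ≤ 1 * ‖∑ i ∈ Finset.range k, θ i • v i‖ := g.le_of_opNorm_le hg _
      _ ≤ M := by rw [one_mul]; exact hM k θ
  have h2 : ∑ i ∈ Finset.range k, ‖g (v i)‖ ≤ 2 * M := by
    calc ∑ i ∈ Finset.range k, ‖g (v i)‖
        ≤ ∑ i ∈ Finset.range k, (|RCLike.re (g (v i))| + |RCLike.im (g (v i))|) :=
          Finset.sum_le_sum fun i _ => RCLike.norm_le_abs_re_add_abs_im _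
      _ ≤ M + M := by
          rw [Finset.sum_add_distrib]
          exact add_le_add (hsign RCLike.reLm RCLike.abs_re_le_norm)
            (hsign RCLike.imLm RCLike.abs_im_le_norm)
      _ = 2 * M := (two_mul M).symm
  calc ‖∑ i ∈ F, c i • v i‖ = ‖g (∑ i ∈ F, c i • v i)‖ := by rw [hgv]; simp
    _ = ‖∑ i ∈ F, c i * g (v i)‖ := by simp
    _ ≤ ∑ i ∈ F, r * ‖g (v i)‖ := by
        refine norm_sum_le_of_le _ fun i hi => ?_
        rw [norm_mul]
        exact mul_le_mul_of_nonneg_right (hc i hi) (norm_nonneg _)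
    _ ≤ ∑ i ∈ Finset.range k, r * ‖g (v i)‖ :=
        Finset.sum_le_sum_of_subset_of_nonneg hk fun i _ _ => by positivity
    _ ≤ 2 * M * r := by
        rw [← Finset.mul_sum, mul_comm]
        exact mul_le_mul_of_nonneg_right h2 hr

theorem ZeroAtInftyContinuousMap.norm_apply_le {E : Type*} [NormedAddCommGroup E] (c : C₀(ℕ, E))
    (i : ℕ) : ‖c i‖ ≤ ‖c‖ := by
  rw [← ZeroAtInftyContinuousMap.norm_toBCF_eq_norm]
  exact c.toBCF.norm_coe_le_norm i

theorem ZeroAtInftyContinuousMap.norm_le_of_forall {E : Type*} [NormedAddCommGroup E]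
    {c : C₀(ℕ, E)} {r : ℝ} (hr : 0 ≤ r) (h : ∀ i, ‖c i‖ ≤ r) : ‖c‖ ≤ r := by
  rw [← ZeroAtInftyContinuousMap.norm_toBCF_eq_norm]
  exact (BoundedContinuousFunction.norm_le hr).2 h

/-- A weakly unconditionally Cauchy sequence satisfying a lower `c₀`-estimate spans `c₀`. -/
theorem containsIsomorphicCopy_zeroAtInfty [CompleteSpace X] {v : ℕ → X} {M κ : ℝ}
    (hM : ∀ (k : ℕ) (θ : ℕ → ℤˣ), ‖∑ i ∈ Finset.range k, θ i • v i‖ ≤ M) (hκ : 0 < κ)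
    (hv : ∀ (n : ℕ) (c : ℕ → 𝕜), ∀ i < n, κ * ‖c i‖ ≤ ‖∑ j ∈ Finset.range n, c j • v j‖) :
    ContainsIsomorphicCopy 𝕜 X C₀(ℕ, 𝕜) := by
  have hM0 : 0 ≤ M := (norm_nonneg _).trans (hM 0 1)
  have hsum : ∀ c : C₀(ℕ, 𝕜), Summable fun i => c i • v i := by
    intro c
    rw [summable_iff_vanishing_norm]
    intro ε hε
    have hc : Tendsto c cofinite (𝓝 0) := by
      have := c.zero_at_infty'
      rwa [cocompact_eq_cofinite] at this
    have hr : 0 < ε / (2 * M + 1) := by positivity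
    have hfin : {i | ¬ ‖c i‖ < ε / (2 * M + 1)}.Finite :=
      (tendsto_zero_iff_norm_tendsto_zero.1 hc).eventually_lt_const hr
    refine ⟨hfin.toFinset, fun F hF => ?_⟩
    refine (norm_sum_smul_le_of_signs hM F c hr.le fun i hi => ?_).trans_lt ?_
    · by_contra h
      exact Finset.disjoint_left.1 hF hi (hfin.mem_toFinset.2 fun h' => h h'.le)
    · rw [mul_div_assoc', div_lt_iff₀ (by positivity)]
      nlinarith
  let T : C₀(ℕ, 𝕜) →ₗ[𝕜] X :=
    { toFun := fun c => ∑' i, c i • v i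
      map_add' := fun c d => by
        simp only [ZeroAtInftyContinuousMap.add_apply, add_smul]
        exact (hsum c).tsum_add (hsum d)
      map_smul' := fun r c => by
        simp only [ZeroAtInftyContinuousMap.smul_apply, smul_assoc, RingHom.id_apply]
        exact (hsum c).tsum_const_smul r }
  have hT : ∀ c, ‖T c‖ ≤ 2 * M * ‖c‖ := fun c =>
    le_of_tendsto' (hsum c).hasSum.norm fun F =>
      norm_sum_smul_le_of_signs hM F c (norm_nonneg _) fun i _ => c.norm_apply_le i
  refine containsIsomorphicCopy_of_bound (T.mkContinuous _ hT) hκ fun c => ?_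
  have hi : ∀ i, κ * ‖c i‖ ≤ ‖T c‖ := fun i =>
    ge_of_tendsto (hsum c).hasSum.tendsto_sum_nat.norm
      (eventually_atTop.2 ⟨i + 1, fun n hn => hv n c i hn⟩)
  rw [← le_div_iff₀' hκ]
  exact ZeroAtInftyContinuousMap.norm_le_of_forall (by positivity) fun i =>
    (le_div_iff₀' hκ).2 (hi i)

end Copies

/-! ### RUC blocks: without c₀ the basis is boundedly complete -/

section

variable {𝕜 : Type*} [RCLike 𝕜] {X : Type*} [NormedAddCommGroup X] [NormedSpace 𝕜 X]

theorem norm_sign_smul {Y : Type*} [NormedAddCommGroup Y] (e : ℤˣ) (y : Y) : ‖e • y‖ = ‖y‖ := by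
  rcases Int.units_eq_one_or e with rfl | rfl <;> simp [Units.smul_def]

theorem seriesConverges_iff_cauchySeq [CompleteSpace X] {y : ℕ → X} :
    SeriesConverges y ↔ CauchySeq fun n => ∑ i ∈ Finset.range n, y i :=
  ⟨fun ⟨_, h⟩ => h.cauchySeq, fun h => cauchySeq_tendsto_of_complete h⟩

theorem SeriesConverges.exists_norm_sum_Ico_lt {y : ℕ → X} (h : SeriesConverges y) {δ : ℝ}
    (hδ : 0 < δ) : ∃ N, ∀ m n, N ≤ m → m ≤ n → ‖∑ i ∈ Finset.Ico m n, y i‖ < δ := by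
  obtain ⟨v, hv⟩ := h
  obtain ⟨N, hN⟩ := Metric.cauchySeq_iff.1 hv.cauchySeq δ hδ
  refine ⟨N, fun m n hm hmn => ?_⟩
  rw [Finset.sum_Ico_eq_sub _ hmn, ← dist_eq_norm]
  exact hN n (hm.trans hmn) m hm

theorem exists_delta_of_not_seriesConverges [CompleteSpace X] {y : ℕ → X}
    (h : ¬ SeriesConverges y) :
    ∃ δ > 0, ∀ N, ∃ m > N, δ ≤ ‖∑ i ∈ Finset.Ico N m, y i‖ := by
  rw [seriesConverges_iff_cauchySeq, Metric.cauchySeq_iff'] at h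
  push Not at h
  obtain ⟨δ, hδ, h⟩ := h
  refine ⟨δ, hδ, fun N => ?_⟩
  obtain ⟨m, hm, hd⟩ := h N
  refine ⟨m, lt_of_le_of_ne hm ?_, ?_⟩
  · rintro rfl
    rw [dist_self] at hd
    exact absurd hδ (not_lt.2 hd)
  · rwa [Finset.sum_Ico_eq_sub _ hm, ← dist_eq_norm]

/-- If all convergent series `∑ a n • u n` converge for almost all signs, and the partial sums of
`∑ u n` are bounded, then they are bounded for almost all signs. -/
theorem ae_exists_norm_sum_sign_le [CompleteSpace X] {u : ℕ → X}
    (hu : ∀ a : ℕ → 𝕜, SeriesConverges (fun n => a n • u n) →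
      RandomlyUnconditionallyConvergent fun n => a n • u n)
    {M : ℝ} (hM : ∀ n, ‖∑ i ∈ Finset.range n, u i‖ ≤ M) :
    ∀ᵐ ε ∂signMeasure, ∃ R : ℝ, ∀ n, ‖∑ i ∈ Finset.range n, (ε i : ℤˣ) • u i‖ ≤ R := by
  let S : ℕ → (ℕ → ℤˣ) → X := fun n ε => ∑ i ∈ Finset.range n, ε i • u i
  have hS : ∀ n, StronglyMeasurable (S n) := fun n => stronglyMeasurable_sum_sign_smul _ u
  let U : Set (ℕ → ℤˣ) := {ε | ¬ ∃ R : ℝ, ∀ n, ‖S n ε‖ ≤ R}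
  have hUeq : U = ⋂ R : ℕ, ⋃ n : ℕ, {ε | (R : ℝ) < ‖S n ε‖} := by
    ext ε
    simp only [U, Set.mem_ofPred_eq, Set.mem_iInter, Set.mem_iUnion]
    push Not
    refine ⟨fun h R => h R, fun h R => ?_⟩
    obtain ⟨k, hk⟩ := exists_nat_ge R
    obtain ⟨n, hn⟩ := h k
    exact ⟨n, hk.trans_lt hn⟩
  have hU : MeasurableSet U := by
    rw [hUeq]
    exact MeasurableSet.iInter fun R => MeasurableSet.iUnion fun n =>
      measurableSet_lt measurable_const (hS n).norm.measurable
  -- Signs whose sums move by more than `R` from their value at `N` by time `m`; for fixed `N` and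
  -- `R` they exhaust `U` as `m` grows.
  let E : ℕ → ℝ → ℕ → Set (ℕ → ℤˣ) := fun N R m =>
    {ε | ∃ n, N ≤ n ∧ n ≤ m ∧ R < ‖S n ε - S N ε‖}
  have hE : ∀ N R m, MeasurableSet (E N R m) := fun N R m => by
    have : E N R m = ⋃ n ∈ Finset.Icc N m, {ε | R < ‖S n ε - S N ε‖} := by
      ext ε
      simp [E, and_assoc]
    rw [this]
    exact Finset.measurableSet_biUnion _ fun n _ =>
      measurableSet_lt measurable_const ((hS n).sub (hS N)).norm.measurable
  have hEmono : ∀ N R, Monotone (E N R) := fun N R m m' hmm ε ⟨n, h1, h2, h3⟩ =>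
    ⟨n, h1, h2.trans hmm, h3⟩
  have hEU : ∀ N R, ⋂ m, U \ E N R m = ∅ := by
    intro N R
    rw [Set.eq_empty_iff_forall_notMem]
    intro ε hε
    simp only [Set.mem_iInter, Set.mem_sdiff] at hε
    refine (hε 0).1 ⟨max 0 R + ‖S N ε‖ + ∑ n ∈ Finset.range N, ‖S n ε‖, fun n => ?_⟩
    rcases lt_or_ge n N with hn | hn
    · have h1 := Finset.single_le_sum (f := fun n => ‖S n ε‖) (fun i _ => norm_nonneg _)
        (Finset.mem_range.2 hn)
      have := le_max_left 0 R
      have := norm_nonneg (S N ε)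
      linarith
    · have h1 : ‖S n ε - S N ε‖ ≤ R := not_lt.1 fun h => (hε n).2 ⟨n, hn, le_rfl, h⟩
      have h2 := norm_sub_norm_le (S n ε) (S N ε)
      have := le_max_right 0 R
      have : 0 ≤ ∑ n ∈ Finset.range N, ‖S n ε‖ := Finset.sum_nonneg fun i _ => norm_nonneg _
      linarith
  have hchoice : ∀ N R, ∀ δ : ENNReal, 0 < δ → ∃ m > N, signMeasure (U \ E N R m) < δ := by
    intro N R δ hδ
    have ht : Tendsto (fun m => signMeasure (U \ E N R m)) atTop (𝓝 0) := by
      have := tendsto_measure_iInter_atTop (μ := signMeasure) (s := fun m => U \ E N R m)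
        (fun m => (hU.diff (hE N R m)).nullMeasurableSet)
        (fun m m' hmm => Set.sdiff_subset_sdiff_right (hEmono N R hmm)) ⟨0, by finiteness⟩
      rwa [hEU, measure_empty] at this
    obtain ⟨m, hm, hmN⟩ := ((ht.eventually_lt_const hδ).and (eventually_gt_atTop N)).exists
    exact ⟨m, hmN, hm⟩
  choose nxt hnxt hnxtE using hchoice
  obtain ⟨q, hq, hqE⟩ : ∃ q : ℕ → ℕ, StrictMono q ∧
      ∀ k, signMeasure (U \ E (q k) (2 ^ k) (q (k + 1))) < (2 : ENNReal)⁻¹ ^ k := by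
    let q : ℕ → ℕ := fun k => Nat.rec (motive := fun _ => ℕ) 0 (fun k N => nxt N (2 ^ k)
      ((2 : ENNReal)⁻¹ ^ k) (ENNReal.pow_pos (ENNReal.inv_pos.2 ENNReal.ofNat_ne_top) k)) k
    exact ⟨q, strictMono_nat_of_lt_succ fun k => hnxt _ _ _ _, fun k => hnxtE _ _ _ _⟩
  -- Borel–Cantelli: almost every point of `U` makes an excursion above 2ᵏ within the `k`-th block,
  -- for all large `k`.
  have hBC := ae_eventually_notMem (μ := signMeasure)
    (s := fun k => U \ E (q k) (2 ^ k) (q (k + 1)))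
    (ne_top_of_le_ne_top (by rw [ENNReal.tsum_geometric]; simp)
      (ENNReal.tsum_le_tsum fun k => (hqE k).le))
  let lev : ℕ → ℕ := fun j => Nat.findGreatest (fun i => q i ≤ j) j
  have hlev : ∀ k j, q k ≤ j → j < q (k + 1) → lev j = k := fun k j h1 h2 =>
    Nat.findGreatest_eq_of_mem_Ico hq h1 h2
  have hlevmono : Monotone lev := fun i j hij =>
    Nat.findGreatest_mono (fun n hn => le_trans hn hij) hij
  have hlevlim : Tendsto lev atTop atTop := tendsto_atTop_atTop_of_monotone hlevmono fun b =>
    ⟨q b, (hlev b _ le_rfl (hq b.lt_succ_self)).ge⟩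
  -- The weight 2⁻ᵏ on the `k`-th block decreases to 0, as Dirichlet's test requires, but still
  -- turns excursions above 2ᵏ into oscillations above 1.
  let f : ℕ → ℝ := fun j => 2⁻¹ ^ lev j
  have hfanti : Antitone f := fun i j hij =>
    pow_le_pow_of_le_one (by norm_num) (by norm_num) (hlevmono hij)
  have hflim : Tendsto f atTop (𝓝 0) :=
    (tendsto_pow_atTop_nhds_zero_of_lt_one (by norm_num) (by norm_num)).comp hlevlim
  let _ : NormedSpace ℝ X := NormedSpace.restrictScalars ℝ 𝕜 X
  have hconv : SeriesConverges fun n => ((f n : ℝ) : 𝕜) • u n := by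
    rw [seriesConverges_iff_cauchySeq]
    have := hfanti.cauchySeq_series_mul_of_tendsto_zero_of_bounded hflim (z := u) hM
    exact this
  filter_upwards [hBC, hu _ hconv] with ε h1 h2
  by_contra hεU
  obtain ⟨N, hN⟩ := h2.exists_norm_sum_Ico_lt one_pos
  obtain ⟨k, hk, hkN⟩ := (h1.and (eventually_ge_atTop N)).exists
  have hεE : ε ∈ E (q k) (2 ^ k) (q (k + 1)) :=
    not_not.1 fun h => hk ⟨hεU, h⟩
  obtain ⟨n, hn1, hn2, hn3⟩ := hεE
  have h3 := hN (q k) n (hkN.trans (hq.id_le k)) hn1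
  have h4 : ∑ i ∈ Finset.Ico (q k) n, ε i • (((f i : ℝ) : 𝕜) • u i) =
      (((2 : ℝ)⁻¹ ^ k : ℝ) : 𝕜) • (S n ε - S (q k) ε) := by
    rw [← Finset.sum_Ico_eq_sub _ hn1, Finset.smul_sum]
    refine Finset.sum_congr rfl fun i hi => ?_
    rw [Finset.mem_Ico] at hi
    simp only [f, hlev k i hi.1 (hi.2.trans_le hn2)]
    rw [smul_comm]
  rw [h4, norm_smul, RCLike.norm_ofReal, abs_of_pos (by positivity), inv_pow,
    inv_mul_lt_iff₀ (by positivity), mul_one] at h3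
  exact lt_asymm h3 hn3

/-- If the partial sums of `∑ ε n • u n` are bounded for almost all signs `ε`, then the sums of
some subsequence are bounded for all signs. -/
theorem exists_strictMono_forall_norm_sum_sign_le (𝕜 : Type*) [RCLike 𝕜] {X : Type*}
    [NormedAddCommGroup X] [NormedSpace 𝕜 X] {u : ℕ → X}
    (hu : ∀ᵐ ε ∂signMeasure, ∃ R : ℝ, ∀ n, ‖∑ i ∈ Finset.range n, (ε i : ℤˣ) • u i‖ ≤ R) :
    ∃ φ : ℕ → ℕ, StrictMono φ ∧ ∃ M : ℝ, ∀ (k : ℕ) (θ : ℕ → ℤˣ),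
      ‖∑ i ∈ Finset.range k, θ i • u (φ i)‖ ≤ M := by
  let A : ℕ → Set (ℕ → ℤˣ) := fun M =>
    {ε | ∀ n, ‖∑ i ∈ Finset.range n, (ε i : ℤˣ) • u i‖ ≤ M}
  have hA : ∀ M, MeasurableSet (A M) := fun M => by
    have : A M = ⋂ n, {ε | ‖∑ i ∈ Finset.range n, (ε i : ℤˣ) • u i‖ ≤ M} := by
      ext ε
      simp [A]
    rw [this]
    exact MeasurableSet.iInter fun n => measurableSet_le
      (stronglyMeasurable_sum_sign_smul _ u).norm.measurable measurable_const
  have hAmono : Monotone A := fun M M' h ε hε n => (hε n).trans (Nat.cast_le.2 h)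
  have hAU : signMeasure (⋃ M, A M) = 1 := by
    rw [← measure_univ (μ := signMeasure)]
    refine measure_congr ?_
    filter_upwards [hu] with ε ⟨R, hR⟩
    obtain ⟨M, hM⟩ := exists_nat_ge R
    exact propext ⟨fun _ => trivial, fun _ => Set.mem_iUnion.2 ⟨M, fun n => (hR n).trans hM⟩⟩
  have hlim := tendsto_measure_iUnion_atTop (μ := signMeasure) hAmono
  rw [hAU] at hlim
  have hlim' : Tendsto (fun M => signMeasure.real (A M)) atTop (𝓝 1) :=
    (ENNReal.tendsto_toReal ENNReal.one_ne_top).comp hlim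
  obtain ⟨M, hM⟩ := (hlim'.eventually_const_lt (u := 1 / 2) (by norm_num)).exists
  obtain ⟨φ, hφ, hrefl⟩ := exists_strictMono_forall_exists_reflection (hA M) hM
  refine ⟨φ, hφ, M, fun k θ => ?_⟩
  obtain ⟨ε, hε, hεθ, hε'⟩ := hrefl k θ
  have hsub : (Finset.range k).image φ ⊆ Finset.range (φ k) := fun n hn => by
    obtain ⟨i, hi, rfl⟩ := Finset.mem_image.1 hn
    exact Finset.mem_range.2 (hφ (Finset.mem_range.1 hi))
  -- A sign sequence and its reflection cancel off the selected indices and double the prescribed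
  -- terms.
  have hkey : ∑ n ∈ Finset.range (φ k), ε n • u n +
      ∑ n ∈ Finset.range (φ k), (if n ∈ (Finset.range k).image φ then ε n else -ε n) • u n =
      (2 : 𝕜) • ∑ i ∈ Finset.range k, θ i • u (φ i) := by
    rw [← Finset.sum_add_distrib, ← Finset.sum_subset hsub (f := fun n => ε n • u n +
      (if n ∈ (Finset.range k).image φ then ε n else -ε n) • u n) fun n _ hn => by
        simp only [if_neg hn]
        simp [Units.smul_def],
      Finset.sum_image fun i _ j _ h => hφ.injective h, Finset.smul_sum]
    refine Finset.sum_congr rfl fun i hi => ?_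
    rw [if_pos (Finset.mem_image_of_mem φ hi), hεθ i (Finset.mem_range.1 hi), two_smul]
  have h2 : 2 * ‖∑ i ∈ Finset.range k, θ i • u (φ i)‖ ≤ M + M := by
    calc 2 * ‖∑ i ∈ Finset.range k, θ i • u (φ i)‖
        = ‖(2 : 𝕜) • ∑ i ∈ Finset.range k, θ i • u (φ i)‖ := by
          rw [norm_smul, RCLike.norm_ofNat]
      _ ≤ M + M := by
          rw [← hkey]
          exact norm_add_le_of_le (hε _) (hε' _)
  linarith

theorem isBoundedlyComplete_of_not_contains_zeroAtInfty [CompleteSpace X] (x : SchauderBasis 𝕜 X)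
    (hx : ∀ u : ℕ → X, IsBlockSubsequence 𝕜 x u → IsRUC 𝕜 u)
    (h : ¬ ContainsIsomorphicCopy 𝕜 X C₀(ℕ, 𝕜)) : IsBoundedlyComplete x := by
  rintro a ⟨M, hM⟩
  by_contra hconv
  obtain ⟨δ, hδ, hblock⟩ := exists_delta_of_not_seriesConverges hconv
  choose nxt hnxt hnorm using hblock
  let p : ℕ → ℕ := fun k => nxt^[k] 0
  have hpsucc : ∀ k, p (k + 1) = nxt (p k) := fun k => Function.iterate_succ_apply' _ _ _
  have hp : StrictMono p := strictMono_nat_of_lt_succ fun k => by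
    rw [hpsucc]
    exact hnxt _
  let u : ℕ → X := fun j => ∑ n ∈ Finset.Ico (p j) (p (j + 1)), a n • x n
  have huδ : ∀ j, δ ≤ ‖u j‖ := fun j => by
    simp only [u, hpsucc]
    exact hnorm _
  have hblock : IsBlockSubsequence 𝕜 x u := ⟨p, a, hp, fun j => ⟨rfl, fun h0 => by
    have := huδ j
    rw [h0, norm_zero] at this
    exact absurd hδ (not_lt.2 this)⟩⟩
  have hbdd : ∀ n, ‖∑ j ∈ Finset.range n, u j‖ ≤ M + M := fun n => by
    simp only [u]
    rw [sum_range_sum_Ico_eq hp.monotone, Finset.sum_Ico_eq_sub _ (hp.monotone (Nat.zero_le n))]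
    exact (norm_sub_le _ _).trans (add_le_add (hM _) (hM _))
  obtain ⟨φ, hφ, M', hM'⟩ := exists_strictMono_forall_norm_sum_sign_le 𝕜
    (ae_exists_norm_sum_sign_le (hx u hblock).randomly_convergent hbdd)
  obtain ⟨C, hC1, hC⟩ := SchauderBasis.exists_proj_bound x
  have hC0 : 0 < C := by linarith
  -- Each term is a difference of two basis projections of the sum, so its norm is at most 2C times
  -- that of the sum, while the block has norm at least `δ`.
  refine h (containsIsomorphicCopy_zeroAtInfty hM' (κ := δ / (2 * C)) (by positivity)
    fun n c i hi => ?_)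
  set s := ∑ j ∈ Finset.range n, c j • u (φ j)
  have hproj : ∀ m, SchauderBasis.proj x (p m) s =
      ∑ j ∈ Finset.range n, if φ j < m then c j • u (φ j) else 0 := fun m => by
    simp only [s, map_sum, map_smul, SchauderBasis.proj_block x hp.monotone (a := a) (u := u)
      (fun _ => rfl), smul_ite, smul_zero]
  have hci : SchauderBasis.proj x (p (φ i + 1)) s - SchauderBasis.proj x (p (φ i)) s =
      c i • u (φ i) := by
    rw [hproj, hproj, ← Finset.sum_sub_distrib, Finset.sum_eq_single i]
    · simp
    · intro j _ hj
      have : φ j ≠ φ i := fun h => hj (hφ.injective h)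
      have : φ j < φ i + 1 ↔ φ j < φ i := by omega
      simp [this]
    · exact fun h => absurd (Finset.mem_range.2 hi) h
  have h1 : ‖c i • u (φ i)‖ ≤ C * ‖s‖ + C * ‖s‖ := by
    rw [← hci]
    exact (norm_sub_le _ _).trans (add_le_add (hC _ _) (hC _ _))
  rw [norm_smul] at h1
  have h2 : ‖c i‖ * δ ≤ ‖c i‖ * ‖u (φ i)‖ :=
    mul_le_mul_of_nonneg_left (huδ _) (norm_nonneg _)
  rw [div_mul_eq_mul_div, div_le_iff₀ (by positivity)]
  linarith

end

/-! ### A boundedly complete basis excludes c₀ -/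

section

variable {𝕜 : Type*} [RCLike 𝕜] {X : Type*} [NormedAddCommGroup X] [NormedSpace 𝕜 X]

variable (𝕜) in
/-- The finitely supported element of `C₀(ℕ, 𝕜)` with coefficients `c` on `F`. -/
noncomputable def ZeroAtInftyContinuousMap.indicatorFinset (F : Finset ℕ) (c : ℕ → 𝕜) :
    C₀(ℕ, 𝕜) where
  toFun := Set.indicator F c
  continuous_toFun := continuous_of_discreteTopology
  zero_at_infty' := by
    rw [cocompact_eq_cofinite]
    refine tendsto_const_nhds.congr' ?_
    filter_upwards [F.finite_toSet.compl_mem_cofinite] with n hn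
    exact (Set.indicator_of_notMem hn c).symm

open ZeroAtInftyContinuousMap in
theorem norm_indicatorFinset_le (F : Finset ℕ) (c : ℕ → 𝕜) {r : ℝ} (hr : 0 ≤ r)
    (hc : ∀ i, ‖c i‖ ≤ r) : ‖indicatorFinset 𝕜 F c‖ ≤ r := by
  refine norm_le_of_forall hr fun i => (norm_indicator_le_norm_self c i).trans (hc i)

open ZeroAtInftyContinuousMap in
theorem indicatorFinset_eq_sum (F : Finset ℕ) (c : ℕ → 𝕜) :
    indicatorFinset 𝕜 F c = ∑ i ∈ F, c i • indicatorFinset 𝕜 {i} 1 := by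
  classical
  let ev : ℕ → C₀(ℕ, 𝕜) →+ 𝕜 := fun n =>
    { toFun := fun f => f n, map_zero' := rfl, map_add' := fun _ _ => rfl }
  ext n
  change _ = ev n _
  rw [map_sum]
  change Set.indicator F c n = ∑ i ∈ F, c i * Set.indicator ({i} : Finset ℕ) 1 n
  simp [Set.indicator_apply]

open ZeroAtInftyContinuousMap in
/-- Bounded functionals on `c₀` tend to `0` along the unit vectors. -/
theorem tendsto_apply_unitVector (g : C₀(ℕ, 𝕜) →L[𝕜] 𝕜) :
    Tendsto (fun n => g (indicatorFinset 𝕜 {n} 1)) atTop (𝓝 0) := by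
  set z : ℕ → 𝕜 := fun n => g (indicatorFinset 𝕜 {n} 1)
  have hsum : Summable fun n => ‖z n‖ := by
    refine summable_of_sum_le (c := ‖g‖) (fun n => norm_nonneg _) fun F => ?_
    -- Phases aligning the values `z n`, so that a vector of norm at most 1 detects ∑ ‖z n‖ over
    -- `F`; division by zero gives 0 where `z n` vanishes.
    let c : ℕ → 𝕜 := fun n => (starRingEnd 𝕜) (z n) / (‖z n‖ : 𝕜)
    have hc : ∀ n, c n * z n = (‖z n‖ : 𝕜) := fun n => by
      by_cases h : z n = 0
      · simp [h]
      · have : (‖z n‖ : 𝕜) ≠ 0 := by simpa using h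
        simp only [c]
        rw [div_mul_eq_mul_div, RCLike.conj_mul, sq, mul_div_assoc, div_self this, mul_one]
    have hc1 : ∀ n, ‖c n‖ ≤ 1 := fun n => by
      simp only [c, norm_div, RCLike.norm_conj, RCLike.norm_ofReal, abs_norm]
      exact div_self_le_one _
    have h1 : g (indicatorFinset 𝕜 F c) = ((∑ n ∈ F, ‖z n‖ : ℝ) : 𝕜) := by
      rw [indicatorFinset_eq_sum, map_sum]
      push_cast
      refine Finset.sum_congr rfl fun n _ => ?_
      rw [map_smul, smul_eq_mul]
      exact hc n
    have h2 := g.le_opNorm_of_le (norm_indicatorFinset_le F c zero_le_one hc1)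
    rw [h1, RCLike.norm_ofReal, mul_one] at h2
    exact (le_abs_self _).trans h2
  exact tendsto_zero_iff_norm_tendsto_zero.2 hsum.tendsto_atTop_zero

theorem ContainsIsomorphicCopy.exists_embedding {E : Type*} [NormedAddCommGroup E]
    [NormedSpace 𝕜 E] (h : ContainsIsomorphicCopy 𝕜 X E) :
    ∃ (T : E →L[𝕜] X) (K : ℝ), 0 < K ∧ ∀ e, ‖e‖ ≤ K * ‖T e‖ := by
  obtain ⟨Y, ⟨e⟩⟩ := h
  refine ⟨Y.subtypeL.comp (e.symm : E →L[𝕜] Y), ‖(e : Y →L[𝕜] E)‖ + 1, by positivity, fun v => ?_⟩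
  have h1 := (e : Y →L[𝕜] E).le_opNorm (e.symm v)
  simp only [ContinuousLinearEquiv.coe_coe, ContinuousLinearEquiv.apply_symm_apply] at h1
  refine h1.trans ?_
  simp only [ContinuousLinearMap.comp_apply, Submodule.subtypeL_apply, Submodule.coe_norm,
    ContinuousLinearEquiv.coe_coe]
  gcongr
  linarith

open ZeroAtInftyContinuousMap in
theorem not_contains_zeroAtInfty_of_isBoundedlyComplete [CompleteSpace X] (x : SchauderBasis 𝕜 X)
    (hx : IsBoundedlyComplete x) : ¬ ContainsIsomorphicCopy 𝕜 X C₀(ℕ, 𝕜) := by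
  intro hcopy
  obtain ⟨T, K, hK, hT⟩ := hcopy.exists_embedding
  let y : ℕ → X := fun n => T (indicatorFinset 𝕜 {n} 1)
  have hy : ∀ n, 1 ≤ K * ‖y n‖ := fun n => by
    refine le_trans ?_ (hT _)
    refine le_trans ?_ (norm_apply_le _ n)
    simp [indicatorFinset, DFunLike.coe]
  have hyF : ∀ F : Finset ℕ, ‖∑ n ∈ F, y n‖ ≤ ‖T‖ := fun F => by
    have h1 := T.le_opNorm_of_le (norm_indicatorFinset_le (𝕜 := 𝕜) F 1 zero_le_one (by simp))
    rw [indicatorFinset_eq_sum, map_sum, mul_one] at h1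
    simpa using h1
  have hproj : ∀ N, Tendsto (fun n => SchauderBasis.proj x N (y n)) atTop (𝓝 0) := fun N => by
    simp only [SchauderBasis.proj_apply]
    rw [← Finset.sum_const_zero (s := Finset.range N)]
    refine tendsto_finsetSum _ fun i _ => ?_
    have := (tendsto_apply_unitVector ((x.coord i).comp T)).smul_const (x i)
    simpa using this
  -- One step of the gliding hump: a far unit vector is almost invisible to the first `N`
  -- coordinates and almost exhausted by the first `m`.
  have hstep : ∀ (j N n₀ : ℕ), ∃ n > n₀, ∃ m > N,
      ‖SchauderBasis.proj x N (y n)‖ < 2⁻¹ ^ j ∧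
      ‖SchauderBasis.proj x m (y n) - y n‖ < 2⁻¹ ^ j := fun j N n₀ => by
    have hpos : (0 : ℝ) < 2⁻¹ ^ j := by positivity
    have h1 := (tendsto_zero_iff_norm_tendsto_zero.1 (hproj N)).eventually_lt_const hpos
    obtain ⟨n, hn, hn₀⟩ := (h1.and (eventually_gt_atTop n₀)).exists
    have h2 := (tendsto_iff_norm_sub_tendsto_zero.1
      (SchauderBasis.tendsto_proj x (y n))).eventually_lt_const hpos
    obtain ⟨m, hm, hmN⟩ := (h2.and (eventually_gt_atTop N)).exists
    exact ⟨n, hn₀, m, hmN, hn, hm⟩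
  choose fn hfn fm hfm hlo hhi using hstep
  obtain ⟨p, ν, hp0, hp, hν, hplo, hphi⟩ : ∃ p ν : ℕ → ℕ, p 0 = 0 ∧ StrictMono p ∧ StrictMono ν ∧
      (∀ j, ‖SchauderBasis.proj x (p j) (y (ν j))‖ < 2⁻¹ ^ j) ∧
      ∀ j, ‖SchauderBasis.proj x (p (j + 1)) (y (ν j)) - y (ν j)‖ < 2⁻¹ ^ j := by
    let st : ℕ → ℕ × ℕ := fun k => Nat.rec (motive := fun _ => ℕ × ℕ) (0, 0)
      (fun j s => (fm j s.1 s.2, fn j s.1 s.2)) k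
    exact ⟨fun j => (st j).1, fun j => (st (j + 1)).2, rfl,
      strictMono_nat_of_lt_succ fun j => hfm _ _ _, strictMono_nat_of_lt_succ fun j => hfn _ _ _,
      fun j => hlo _ _ _, fun j => hhi _ _ _⟩
  obtain ⟨a, ha⟩ := SchauderBasis.exists_coeff_of_proj_sub x hp (fun j => y (ν j))
  obtain ⟨C, hC1, hC⟩ := SchauderBasis.exists_proj_bound x
  have hclose : ∀ j, ‖∑ n ∈ Finset.Ico (p j) (p (j + 1)), a n • x n - y (ν j)‖ ≤
      2 * 2⁻¹ ^ j := fun j => by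
    rw [← ha j, sub_right_comm, two_mul]
    exact norm_sub_le_of_le (hphi j).le (hplo j).le
  -- Here 4 = ∑ 2 · 2⁻ʲ is the total perturbation.
  have hblocks : ∀ n, ‖∑ i ∈ Finset.range (p n), a i • x i‖ ≤ ‖T‖ + 4 := fun n => by
    have h1 : ∑ i ∈ Finset.range (p n), a i • x i = ∑ j ∈ Finset.range n, y (ν j) +
        ∑ j ∈ Finset.range n, (∑ i ∈ Finset.Ico (p j) (p (j + 1)), a i • x i - y (ν j)) := by
      rw [← Finset.sum_add_distrib]
      simp only [add_sub_cancel]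
      rw [sum_range_sum_Ico_eq hp.monotone, hp0, Finset.range_eq_Ico]
    rw [h1]
    refine norm_add_le_of_le ?_ ?_
    · rw [← Finset.sum_image (f := y) fun i _ j _ h => hν.injective h]
      exact hyF _
    · refine (norm_sum_le_of_le _ fun j _ => hclose j).trans ?_
      rw [← Finset.mul_sum]
      have := (summable_geometric_of_lt_one (r := (2 : ℝ)⁻¹) (by norm_num)
        (by norm_num)).sum_le_tsum (Finset.range n) fun j _ => by positivity
      rw [tsum_geometric_of_lt_one (by norm_num) (by norm_num)] at this
      norm_num at this ⊢
      linarith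
  -- Since `n ≤ p n`, the `n`-th partial sum is a projection of the one at the block end `p n`.
  have hconv := hx a ⟨C * (‖T‖ + 4), fun n => by
    have h1 := SchauderBasis.proj_sum_Ico x a 0 (p n) n
    rw [min_eq_right (show n ≤ p n from hp.id_le n), ← Finset.range_eq_Ico, ← Finset.range_eq_Ico] at h1
    rw [← h1]
    refine (hC _ _).trans ?_
    gcongr
    exact hblocks n⟩
  obtain ⟨N, hN⟩ := hconv.exists_norm_sum_Ico_lt (δ := (2 * K)⁻¹) (by positivity)
  have hsmall : Tendsto (fun j : ℕ => 2 * (2 : ℝ)⁻¹ ^ j) atTop (𝓝 (2 * 0)) :=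
    (tendsto_pow_atTop_nhds_zero_of_lt_one (by norm_num) (by norm_num)).const_mul 2
  rw [mul_zero] at hsmall
  obtain ⟨j, hj, hjN⟩ := ((hsmall.eventually_lt_const
    (show (0 : ℝ) < (2 * K)⁻¹ by positivity)).and (eventually_ge_atTop N)).exists
  have h1 := hN (p j) (p (j + 1)) (hjN.trans (hp.id_le j)) (hp.monotone j.le_succ)
  have h2 := (norm_sub_norm_le (y (ν j)) (∑ n ∈ Finset.Ico (p j) (p (j + 1)), a n • x n)).trans
    ((norm_sub_rev _ _).le.trans (hclose j))
  have h3 : ‖y (ν j)‖ < K⁻¹ := by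
    have : K⁻¹ = (2 * K)⁻¹ + (2 * K)⁻¹ := by
      field_simp
      norm_num
    linarith
  have h4 := hy (ν j)
  have h5 : K * ‖y (ν j)‖ < 1 := by
    rwa [← lt_div_iff₀' hK, one_div]
  exact absurd h4 (not_le.2 h5)

end

/-! ### Rosenthal's ℓ₁ theorem at a fixed scale -/

section

variable {𝕜 : Type*} [RCLike 𝕜] {X : Type*} [NormedAddCommGroup X] [NormedSpace 𝕜 X]

/-- If functionals of norm at most one can take values near `z` and near `z'` on the terms of a
sequence in any prescribed pattern, then the sequence satisfies a lower `ℓ₁`-estimate. -/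
theorem le_norm_sum_smul_of_independent {v : ℕ → X} {z z' : 𝕜} {r : ℝ}
    (hz : 16 * r ≤ ‖z - z'‖)
    (hind : ∀ (θ : ℕ → Prop) (n : ℕ), ∃ g : StrongDual 𝕜 X, ‖g‖ ≤ 1 ∧ ∀ j < n,
      (θ j → ‖g (v j) - z‖ < r) ∧ (¬ θ j → ‖g (v j) - z'‖ < r)) (n : ℕ) (c : ℕ → 𝕜) :
    3 * r * ∑ i ∈ Finset.range n, ‖c i‖ ≤ ‖∑ i ∈ Finset.range n, c i • v i‖ := by
  -- The real or imaginary part, whichever carries at least half of ∑ ‖c i‖; its signs set the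
  -- pattern. With `g` following it and `g'` its opposite, `g - g'` is within 2r of ±(z - z') on
  -- each term.
  obtain ⟨ψ, hψ, hψc⟩ : ∃ ψ : 𝕜 →ₗ[ℝ] ℝ, (∀ y, |ψ y| ≤ ‖y‖) ∧
      ∑ i ∈ Finset.range n, ‖c i‖ ≤ 2 * ∑ i ∈ Finset.range n, |ψ (c i)| := by
    have h1 : ∑ i ∈ Finset.range n, ‖c i‖ ≤ ∑ i ∈ Finset.range n, |RCLike.reLm (c i)| +
        ∑ i ∈ Finset.range n, |RCLike.imLm (c i)| := by
      rw [← Finset.sum_add_distrib]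
      exact Finset.sum_le_sum fun i _ => RCLike.norm_le_abs_re_add_abs_im _
    rcases le_total (∑ i ∈ Finset.range n, |RCLike.reLm (c i)|)
      (∑ i ∈ Finset.range n, |RCLike.imLm (c i)|) with h | h
    · exact ⟨RCLike.imLm, RCLike.abs_im_le_norm, by linarith⟩
    · exact ⟨RCLike.reLm, RCLike.abs_re_le_norm, by linarith⟩
  obtain ⟨g, hg, hgv⟩ := hind (fun j => 0 ≤ ψ (c j)) n
  obtain ⟨g', hg', hgv'⟩ := hind (fun j => ¬ 0 ≤ ψ (c j)) n
  let s : ℕ → ℝ := fun j => if 0 ≤ ψ (c j) then 1 else -1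
  have hs : ∀ j, s j * ψ (c j) = |ψ (c j)| := fun j => by
    simp only [s]
    split_ifs with h
    · rw [abs_of_nonneg h, one_mul]
    · rw [abs_of_neg (not_le.1 h), neg_one_mul]
  have hclose : ∀ j < n, ‖(g - g') (v j) - (s j : 𝕜) * (z - z')‖ ≤ 2 * r := by
    intro j hj
    by_cases h : 0 ≤ ψ (c j)
    · have h1 := (hgv j hj).1 h
      have h2 := (hgv' j hj).2 (not_not.2 h)
      have : (g - g') (v j) - (s j : 𝕜) * (z - z') = (g (v j) - z) - (g' (v j) - z') := by
        simp [s, h]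
        ring
      rw [this]
      exact (norm_sub_le _ _).trans (by linarith)
    · have h1 := (hgv j hj).2 h
      have h2 := (hgv' j hj).1 h
      have : (g - g') (v j) - (s j : 𝕜) * (z - z') = (g (v j) - z') - (g' (v j) - z) := by
        simp [s, h]
        ring
      rw [this]
      exact (norm_sub_le _ _).trans (by linarith)
  have hsum : ∑ i ∈ Finset.range n, |ψ (c i)| ≤ ‖∑ i ∈ Finset.range n, c i * (s i : 𝕜)‖ := by
    refine le_trans (le_of_eq ?_) ((le_abs_self _).trans (hψ _))
    rw [map_sum]
    refine Finset.sum_congr rfl fun i _ => ?_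
    rw [← hs, mul_comm (c i), ← RCLike.real_smul_eq_coe_mul, map_smul, smul_eq_mul]
  have hmain : ‖(∑ i ∈ Finset.range n, c i * (s i : 𝕜)) * (z - z')‖ ≤
      2 * ‖∑ i ∈ Finset.range n, c i • v i‖ + 2 * r * ∑ i ∈ Finset.range n, ‖c i‖ := by
    have h1 : (∑ i ∈ Finset.range n, c i * (s i : 𝕜)) * (z - z') =
        (g - g') (∑ i ∈ Finset.range n, c i • v i) -
          ∑ i ∈ Finset.range n, c i * ((g - g') (v i) - (s i : 𝕜) * (z - z')) := by
      rw [map_sum, Finset.sum_mul, ← Finset.sum_sub_distrib]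
      refine Finset.sum_congr rfl fun i _ => ?_
      rw [map_smul, smul_eq_mul]
      ring
    rw [h1]
    refine norm_sub_le_of_le ?_ ?_
    · refine (g - g').le_of_opNorm_le ((norm_sub_le _ _).trans ?_) _
      linarith
    · rw [Finset.mul_sum]
      refine norm_sum_le_of_le _ fun i hi => ?_
      rw [norm_mul, mul_comm (2 * r)]
      exact mul_le_mul_of_nonneg_left (hclose i (Finset.mem_range.1 hi)) (norm_nonneg _)
  rw [norm_mul] at hmain
  have hr : 0 ≤ r := by
    obtain ⟨g, -, h⟩ := hind (fun _ => True) 1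
    exact (norm_nonneg _).trans ((h 0 one_pos).1 trivial).le
  -- Since ∑ |ψ (c i)| is at least half of ∑ ‖c i‖, this yields 8r ∑ ‖c i‖ ≤ 2 ‖∑ c i • v i‖ + 2r ∑
  -- ‖c i‖, hence the constant 3r.
  have h2 : (∑ i ∈ Finset.range n, |ψ (c i)|) * (16 * r) ≤
      ‖∑ i ∈ Finset.range n, c i * (s i : 𝕜)‖ * ‖z - z'‖ := by gcongr
  have h3 : r * ∑ i ∈ Finset.range n, ‖c i‖ ≤ r * (2 * ∑ i ∈ Finset.range n, |ψ (c i)|) := by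
    gcongr
  linarith

variable [CompleteSpace X]

/-- The dichotomy is applied on the dual ball to the functionals near `z` and near `z'` at `w n`;
independence would produce ℓ₁. -/
theorem exists_strictMono_not_frequently_near {w : ℕ → X} {C : ℝ} (hw : ∀ n, ‖w n‖ ≤ C)
    (hcopy : ¬ ContainsIsomorphicCopy 𝕜 X (lp (fun _ : ℕ => 𝕜) 1)) {z z' : 𝕜} {r : ℝ}
    (hr : 0 < r) (hz : 16 * r ≤ ‖z - z'‖) :
    ∃ φ : ℕ → ℕ, StrictMono φ ∧ ∀ g : StrongDual 𝕜 X, ‖g‖ ≤ 1 →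
      ¬ ((∃ᶠ n in atTop, ‖g (w (φ n)) - z‖ < r) ∧ ∃ᶠ n in atTop, ‖g (w (φ n)) - z'‖ < r) := by
  rcases exists_strictMono_not_frequently_or_independent
    (α := {g : StrongDual 𝕜 X // ‖g‖ ≤ 1}) (fun n => {g | ‖g.1 (w n) - z‖ < r})
    (fun n => {g | ‖g.1 (w n) - z'‖ < r}) with ⟨φ, hφ, h⟩ | ⟨φ, hφ, h⟩
  · exact ⟨φ, hφ, fun g hg => h ⟨g, hg⟩⟩
  · refine absurd (containsIsomorphicCopy_lp_one (v := w ∘ φ) (fun n => hw _)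
      (show 0 < 3 * r by positivity) (le_norm_sum_smul_of_independent hz fun θ n => ?_)) hcopy
    obtain ⟨g, hg⟩ := h θ n
    exact ⟨g.1, g.2, hg⟩

/-- **Rosenthal's `ℓ₁` theorem** at a fixed scale: in the absence of `ℓ₁`, a bounded sequence has
a subsequence with small oscillation at every functional of norm at most one. -/
theorem exists_strictMono_oscillation_le {u : ℕ → X} {C : ℝ} (hu : ∀ n, ‖u n‖ ≤ C)
    (hcopy : ¬ ContainsIsomorphicCopy 𝕜 X (lp (fun _ : ℕ => 𝕜) 1)) {δ : ℝ} (hδ : 0 < δ) :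
    ∃ φ : ℕ → ℕ, StrictMono φ ∧ ∀ g : StrongDual 𝕜 X, ‖g‖ ≤ 1 →
      ∃ J, ∀ i j, J ≤ i → J ≤ j → ‖g (u (φ i)) - g (u (φ j))‖ ≤ δ := by
  -- Along the subsequence every late value is `r`-close to a center within 16r of one fixed center,
  -- so it lies within 17r of the latter, and two such values differ by at most 34r.
  set r := δ / 34 with hrdef
  have hr : 0 < r := by positivity
  obtain ⟨Z, -, hZfin, hZ⟩ := finite_cover_balls_of_compact
    (isCompact_closedBall (0 : 𝕜) C) hr
  have hpairs : ∀ P : Finset (𝕜 × 𝕜), ∃ φ : ℕ → ℕ, StrictMono φ ∧ ∀ q ∈ P,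
      16 * r ≤ ‖q.1 - q.2‖ → ∀ g : StrongDual 𝕜 X, ‖g‖ ≤ 1 →
      ¬ ((∃ᶠ n in atTop, ‖g (u (φ n)) - q.1‖ < r) ∧
        ∃ᶠ n in atTop, ‖g (u (φ n)) - q.2‖ < r) := by
    classical
    intro P
    induction P using Finset.induction_on with
    | empty => exact ⟨id, strictMono_id, by simp⟩
    | insert q P _ ih =>
      obtain ⟨φ, hφ, hφP⟩ := ih
      by_cases hq : 16 * r ≤ ‖q.1 - q.2‖
      · obtain ⟨ψ, hψ, hψq⟩ := exists_strictMono_not_frequently_near (w := u ∘ φ)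
          (fun n => hu _) hcopy hr hq
        refine ⟨φ ∘ ψ, hφ.comp hψ, fun q' hq' hsep g hg hfreq => ?_⟩
        rcases Finset.mem_insert.1 hq' with rfl | hq'
        · exact hψq g hg hfreq
        · exact hφP q' hq' hsep g hg
            ⟨hψ.tendsto_atTop.frequently hfreq.1, hψ.tendsto_atTop.frequently hfreq.2⟩
      · refine ⟨φ, hφ, fun q' hq' hsep => ?_⟩
        rcases Finset.mem_insert.1 hq' with rfl | hq'
        · exact absurd hsep hq
        · exact hφP q' hq' hsep
  obtain ⟨φ, hφ, hφZ⟩ := hpairs (hZfin.toFinset ×ˢ hZfin.toFinset)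
  refine ⟨φ, hφ, fun g hg => ?_⟩
  have hcov : ∀ n, ∃ z ∈ Z, ‖g (u (φ n)) - z‖ < r := fun n => by
    have h1 : g (u (φ n)) ∈ Metric.closedBall (0 : 𝕜) C := by
      rw [mem_closedBall_zero_iff]
      exact (g.le_of_opNorm_le hg _).trans (by rw [one_mul]; exact hu _)
    simpa [dist_eq_norm] using hZ h1
  obtain ⟨z, hzZ, hz⟩ : ∃ z ∈ Z, ∃ᶠ n in atTop, ‖g (u (φ n)) - z‖ < r := by
    by_contra! h
    have h1 : ∀ᶠ n in atTop, ∀ z ∈ Z, ¬ ‖g (u (φ n)) - z‖ < r :=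
      (eventually_all_finite hZfin).2 fun z hz => (h z hz).mono fun n hn => not_lt.2 hn
    obtain ⟨n, hn⟩ := h1.exists
    obtain ⟨z, hz, hzn⟩ := hcov n
    exact hn z hz hzn
  have hfar : ∀ᶠ n in atTop, ∀ z' ∈ Z, 16 * r ≤ ‖z - z'‖ → ¬ ‖g (u (φ n)) - z'‖ < r := by
    refine (eventually_all_finite hZfin).2 fun z' hz' => ?_
    by_cases hsep : 16 * r ≤ ‖z - z'‖
    · have h1 := hφZ (z, z') (by simp [hzZ, hz']) hsep g hg
      filter_upwards [not_frequently.1 fun h2 => h1 ⟨hz, h2⟩] with n hn _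
      exact hn
    · exact Eventually.of_forall fun n h => absurd h hsep
  obtain ⟨J, hJ⟩ := eventually_atTop.1 hfar
  have hnear : ∀ n, J ≤ n → ‖g (u (φ n)) - z‖ ≤ 17 * r := fun n hn => by
    obtain ⟨z', hz', hzn⟩ := hcov n
    have h1 : ‖z - z'‖ < 16 * r := not_le.1 fun h => hJ n hn z' hz' h hzn
    have h2 := norm_sub_le_norm_sub_add_norm_sub (g (u (φ n))) z' z
    rw [norm_sub_rev z' z] at h2
    linarith
  refine ⟨J, fun i j hi hj => ?_⟩
  have h2 := norm_sub_le_norm_sub_add_norm_sub (g (u (φ i))) z (g (u (φ j)))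
  have h3 := hnear i hi
  have h4 := hnear j hj
  rw [norm_sub_rev] at h4
  have : δ = 34 * r := by rw [hrdef]; ring
  linarith

end

/-! ### Combinations with small random signed sums -/

section

variable {𝕜 : Type*} [RCLike 𝕜] {X : Type*} [NormedAddCommGroup X] [NormedSpace 𝕜 X]

theorem sign_smul_eq (e : ℤˣ) (v : X) : e • v = (((e : ℤ) : ℝ) : 𝕜) • v := by
  rcases Int.units_eq_one_or e with rfl | rfl <;> simp [Units.smul_def]

/-- Convex combinations of a bounded sequence with small oscillation on the dual ball: the
differences within groups of `m` consecutive terms are small, for all signs. -/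
theorem exists_convexCombination_oscillation_le {v : ℕ → X} {C δ : ℝ} (hv : ∀ n, ‖v n‖ ≤ C)
    (hδ : 0 < δ) (hosc : ∀ g : StrongDual 𝕜 X, ‖g‖ ≤ 1 →
      ∃ J, ∀ i j, J ≤ i → J ≤ j → ‖g (v i) - g (v j)‖ ≤ δ) {m : ℕ} (hm : 0 < m) (N : ℕ) :
    ∃ a : ℕ →₀ ℝ, (∀ j ∈ a.support, N ≤ j) ∧ (∀ j, 0 ≤ a j) ∧ ∑ j ∈ a.support, a j = 1 ∧
      ∀ g : StrongDual 𝕜 X, ‖g‖ ≤ 1 → ∑ j ∈ a.support,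
        a j * ((m : ℝ)⁻¹ * ∑ i ∈ Finset.range m, ‖g (v (m * j + i) - v (m * j))‖) ≤ 2 * δ := by
  let K : Set (WeakDual 𝕜 X) := WeakDual.toStrongDual ⁻¹' Metric.closedBall 0 1
  have : CompactSpace K := isCompact_iff_compactSpace.1 (WeakDual.isCompact_closedBall 0 1)
  have hK : ∀ k : K, ‖WeakDual.toStrongDual k.1‖ ≤ 1 := fun k => mem_closedBall_zero_iff.1 k.2
  have hm' : (0 : ℝ) < m := Nat.cast_pos.2 hm
  let G : ℕ → K → ℝ := fun j k =>
    (m : ℝ)⁻¹ * ∑ i ∈ Finset.range m, ‖k.1 (v (m * j + i) - v (m * j))‖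
  have hGle : ∀ j k (B : ℝ), (∀ i < m, ‖k.1 (v (m * j + i) - v (m * j))‖ ≤ B) → G j k ≤ B := by
    intro j k B hB
    have := Finset.sum_le_card_nsmul (Finset.range m)
      (fun i => ‖k.1 (v (m * j + i) - v (m * j))‖) B fun i hi => hB i (Finset.mem_range.1 hi)
    rw [Finset.card_range, nsmul_eq_mul] at this
    simp only [G]
    rwa [← div_eq_inv_mul, div_le_iff₀' hm']
  have hG0 : ∀ j k, 0 ≤ G j k := fun j k => by positivity
  have hGC : ∀ j k, G j k ≤ 2 * C := fun j k => hGle j k _ fun i _ => by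
    refine ((WeakDual.toStrongDual k.1).le_of_opNorm_le (hK k) _).trans ?_
    rw [one_mul, two_mul]
    exact norm_sub_le_of_le (hv _) (hv _)
  have hGcont : ∀ j, Continuous (G j) := fun j =>
    continuous_const.mul (continuous_finsetSum _ fun i _ =>
      ((WeakDual.eval_continuous _).comp continuous_subtype_val).norm)
  -- The index `J` depends on the functional, but the excess over `δ` vanishes eventually at each
  -- point of the weak-* compact ball; convex combinations make it uniformly small.
  let H : ℕ → C(K, ℝ) := fun j =>
    ⟨fun k => max (G j k - δ) 0, ((hGcont j).sub continuous_const).max continuous_const⟩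
  obtain ⟨a, ha1, ha2, ha3, ha4⟩ := exists_convexCombination_lt_of_tendsto_zero H (2 * C)
    (fun j k => by
      have h0 := (hG0 j k).trans (hGC j k)
      change |max (G j k - δ) 0| ≤ 2 * C
      rw [abs_of_nonneg (le_max_right _ _)]
      exact max_le (by linarith [hGC j k]) h0)
    (fun k => by
      obtain ⟨J, hJ⟩ := hosc (WeakDual.toStrongDual k.1) (hK k)
      refine tendsto_const_nhds.congr' ?_
      filter_upwards [eventually_ge_atTop J] with j hj
      have hjm : J ≤ m * j := hj.trans (Nat.le_mul_of_pos_left j hm)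
      have : G j k ≤ δ := hGle j k δ fun i _ => by
        rw [map_sub]
        exact hJ _ _ (by omega) hjm
      exact (max_eq_right (by linarith)).symm) hδ N
  refine ⟨a, ha1, ha2, ha3, fun g hg => ?_⟩
  let k : K := ⟨StrongDual.toWeakDual g, by simpa [K] using hg⟩
  have hk := ha4 k
  calc ∑ j ∈ a.support,
        a j * ((m : ℝ)⁻¹ * ∑ i ∈ Finset.range m, ‖g (v (m * j + i) - v (m * j))‖)
      ≤ ∑ j ∈ a.support, (a j * H j k + a j * δ) := by
        refine Finset.sum_le_sum fun j _ => ?_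
        rw [← mul_add]
        refine mul_le_mul_of_nonneg_left ?_ (ha2 j)
        have h1 : G j k - δ ≤ H j k := le_max_left _ _
        change G j k ≤ _
        linarith
    _ ≤ 2 * δ := by
        rw [Finset.sum_add_distrib, ← Finset.sum_mul, ha3]
        linarith

/-- In the absence of `ℓ₁`, every bounded sequence has convex combinations, far out, whose random
signed versions are small in mean. -/
theorem exists_convexCombination_integral_norm_le [CompleteSpace X] {u : ℕ → X} {C : ℝ}
    (hu : ∀ n, ‖u n‖ ≤ C) (hcopy : ¬ ContainsIsomorphicCopy 𝕜 X (lp (fun _ : ℕ => 𝕜) 1))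
    {η : ℝ} (hη : 0 < η) (N : ℕ) :
    ∃ (F : Finset ℕ) (b : ℕ → ℝ), (∀ n ∈ F, N ≤ n) ∧ ∑ n ∈ F, b n = 1 ∧
      ∫ ε, ‖∑ n ∈ F, (ε n : ℤˣ) • ((b n : 𝕜) • u n)‖ ∂signMeasure ≤ η := by
  have hC0 : 0 ≤ C := (norm_nonneg _).trans (hu 0)
  obtain ⟨φ, hφ, hosc⟩ := exists_strictMono_oscillation_le hu hcopy
    (show 0 < η / 4 by positivity)
  -- The average of `m` random signs has mean size at most 1/√m, so groups of this length cost at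
  -- most `η / 2`.
  obtain ⟨m, hm, hmη⟩ : ∃ m : ℕ, 0 < m ∧ C / √m ≤ η / 2 := by
    have h1 : Tendsto (fun m : ℕ => C / √(m : ℝ)) atTop (𝓝 0) :=
      tendsto_const_nhds.div_atTop (Real.tendsto_sqrt_atTop.comp tendsto_natCast_atTop_atTop)
    obtain ⟨m, hm, hm0⟩ := ((h1.eventually_le_const (show 0 < η / 2 by positivity)).and
      (eventually_gt_atTop 0)).exists
    exact ⟨m, hm0, hm⟩
  have hm' : (0 : ℝ) < m := Nat.cast_pos.2 hm
  obtain ⟨a, ha1, ha2, ha3, ha4⟩ := exists_convexCombination_oscillation_le (v := u ∘ φ)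
    (fun n => hu _) (show 0 < η / 4 by positivity) hosc hm N
  let e : ℕ → ℕ → ℕ := fun j i => φ (m * j + i)
  have hdiv : ∀ j i, i < m → (m * j + i) / m = j := fun j i hi => by
    rw [Nat.mul_add_div hm, Nat.div_eq_of_lt hi, add_zero]
  have hinj : Set.InjOn (fun q : ℕ × ℕ => e q.1 q.2) (a.support ×ˢ Finset.range m : Finset _) := by
    rintro ⟨j, i⟩ hq ⟨j', i'⟩ hq' h
    simp only [Finset.coe_product, Finset.coe_range, Set.mem_prod, Set.mem_Iio] at hq hq'
    have h1 : m * j + i = m * j' + i' := hφ.injective h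
    have h2 : j = j' := by
      rw [← hdiv j i hq.2, h1, hdiv j' i' hq'.2]
    subst h2
    simp only [Prod.mk.injEq, true_and]
    omega
  -- The weight `a j` is spread evenly over the `j`-th group of `m` terms.
  let b : ℕ → ℝ := Function.extend φ (fun n => a (n / m) / m) 0
  have hb : ∀ j i, i < m → b (e j i) = a j / m := fun j i hi => by
    simp only [b, e, hφ.injective.extend_apply, hdiv j i hi]
  let F : Finset ℕ := (a.support ×ˢ Finset.range m).image fun q => e q.1 q.2
  have hpt : ∀ ε : ℕ → ℤˣ, ‖∑ n ∈ F, ε n • ((b n : 𝕜) • u n)‖ ≤ η / 2 +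
      ∑ j ∈ a.support, a j * (C / m) * |∑ i ∈ Finset.range m, ((ε (e j i) : ℤ) : ℝ)| := by
    intro ε
    rw [Finset.sum_image hinj, Finset.sum_product]
    -- Each term is compared with the first of its group: the differences are small for all signs,
    -- and what remains is a scalar Rademacher sum times one vector per group.
    have hsplit : ∑ j ∈ a.support, ∑ i ∈ Finset.range m,
        ε (e j i) • ((b (e j i) : 𝕜) • u (e j i)) =
        ∑ j ∈ a.support, ∑ i ∈ Finset.range m,
          ((((ε (e j i) : ℤ) : ℝ) * (a j / m) : ℝ) : 𝕜) • (u (e j i) - u (φ (m * j))) +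
        ∑ j ∈ a.support, (((a j / m) * ∑ i ∈ Finset.range m, ((ε (e j i) : ℤ) : ℝ) : ℝ) : 𝕜) •
          u (φ (m * j)) := by
      rw [← Finset.sum_add_distrib]
      refine Finset.sum_congr rfl fun j _ => ?_
      rw [Finset.mul_sum, RCLike.ofReal_sum, Finset.sum_smul, ← Finset.sum_add_distrib]
      refine Finset.sum_congr rfl fun i hi => ?_
      rw [hb j i (Finset.mem_range.1 hi), sign_smul_eq (𝕜 := 𝕜), smul_smul, ← RCLike.ofReal_mul,
        mul_comm (a j / m), ← smul_add, sub_add_cancel]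
    rw [hsplit]
    refine norm_add_le_of_le ?_ ?_
    · obtain ⟨g, hg, hgv⟩ := exists_dual_vector'' 𝕜 (∑ j ∈ a.support, ∑ i ∈ Finset.range m,
        ((((ε (e j i) : ℤ) : ℝ) * (a j / m) : ℝ) : 𝕜) • (u (e j i) - u (φ (m * j))))
      have h1 := ha4 g hg
      rw [← abs_norm, ← RCLike.norm_ofReal (K := 𝕜), ← hgv]
      refine le_trans ?_ (h1.trans (by linarith))
      rw [map_sum]
      refine norm_sum_le_of_le _ fun j _ => ?_
      rw [map_sum, Finset.mul_sum, Finset.mul_sum]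
      refine norm_sum_le_of_le _ fun i _ => ?_
      rw [map_smul, norm_smul, RCLike.norm_ofReal, abs_mul, abs_sign, one_mul,
        abs_of_nonneg (div_nonneg (ha2 j) hm'.le), div_eq_mul_inv, mul_assoc]
      rfl
    · refine norm_sum_le_of_le _ fun j _ => ?_
      rw [norm_smul, RCLike.norm_ofReal, abs_mul, abs_of_nonneg (div_nonneg (ha2 j) hm'.le)]
      calc a j / m * |∑ i ∈ Finset.range m, ((ε (e j i) : ℤ) : ℝ)| * ‖u (φ (m * j))‖
          ≤ a j / m * |∑ i ∈ Finset.range m, ((ε (e j i) : ℤ) : ℝ)| * C := by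
            gcongr
            · exact mul_nonneg (div_nonneg (ha2 j) hm'.le) (abs_nonneg _)
            · exact hu _
        _ = _ := by ring
  refine ⟨F, b, ?_, ?_, ?_⟩
  · intro n hn
    obtain ⟨⟨j, i⟩, hq, rfl⟩ := Finset.mem_image.1 hn
    have h1 := ha1 j (Finset.mem_product.1 hq).1
    have h2 : m * j + i ≤ φ (m * j + i) := hφ.id_le _
    have h3 : j ≤ m * j := Nat.le_mul_of_pos_left j hm
    simp only [e]
    omega
  · rw [Finset.sum_image hinj, Finset.sum_product, ← ha3]
    refine Finset.sum_congr rfl fun j _ => ?_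
    rw [Finset.sum_congr rfl fun i hi => hb j i (Finset.mem_range.1 hi), Finset.sum_const,
      Finset.card_range, nsmul_eq_mul, mul_div_cancel₀ _ hm'.ne']
  · have hij : ∀ j, Set.InjOn (fun i => e j i) (Finset.range m) := fun j i _ i' _ h => by
      have : m * j + i = m * j + i' := hφ.injective h
      omega
    have hkh : ∀ j, ∫ ε, |∑ i ∈ Finset.range m, ((ε (e j i) : ℤ) : ℝ)| ∂signMeasure ≤ √m := by
      intro j
      have h1 := integral_abs_sum_sign_le ((Finset.range m).image (e j)) 1
      simp only [Finset.sum_image (hij j)] at h1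
      simpa using h1
    have hint : ∀ j, Integrable (fun ε : ℕ → ℤˣ =>
        |∑ i ∈ Finset.range m, ((ε (e j i) : ℤ) : ℝ)|) signMeasure := fun j =>
      integrable_of_abs_le (Finset.measurable_sum _ fun i _ => measurable_sign _).abs m
        fun ε => by
          rw [abs_abs]
          refine (Finset.abs_sum_le_sum_abs _ _).trans ?_
          simp [abs_sign]
    have hint2 : Integrable (fun ε : ℕ → ℤˣ => ∑ j ∈ a.support,
        a j * (C / m) * |∑ i ∈ Finset.range m, ((ε (e j i) : ℤ) : ℝ)|) signMeasure :=
      integrable_finsetSum _ fun j _ => (hint j).const_mul _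
    calc ∫ ε, ‖∑ n ∈ F, (ε n : ℤˣ) • ((b n : 𝕜) • u n)‖ ∂signMeasure
        ≤ ∫ ε, (η / 2 + ∑ j ∈ a.support,
            a j * (C / m) * |∑ i ∈ Finset.range m, ((ε (e j i) : ℤ) : ℝ)|) ∂signMeasure :=
          integral_mono_of_nonneg (Eventually.of_forall fun _ => norm_nonneg _)
            ((integrable_const _).add hint2) (Eventually.of_forall hpt)
      _ = η / 2 + ∑ j ∈ a.support, a j * (C / m) *
            ∫ ε, |∑ i ∈ Finset.range m, ((ε (e j i) : ℤ) : ℝ)| ∂signMeasure := by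
          rw [integral_add (integrable_const _) hint2,
            integral_finsetSum _ fun j _ => (hint j).const_mul _]
          simp only [integral_const_mul, integral_const, probReal_univ, one_smul]
      _ ≤ η / 2 + ∑ j ∈ a.support, a j * (C / m) * √m := by
          gcongr with j _
          · exact mul_nonneg (ha2 j) (by positivity)
          · exact hkh j
      _ = η / 2 + C / √m := by
          rw [← Finset.sum_mul, ← Finset.sum_mul, ha3, one_mul, div_mul_eq_mul_div, mul_div_assoc,
            Real.sqrt_div_self, ← div_eq_mul_inv]
      _ ≤ η := by linarith

end

/-! ### Shrinking bases and ℓ₁ -/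

section

variable {𝕜 : Type*} [RCLike 𝕜] {X : Type*} [NormedAddCommGroup X] [NormedSpace 𝕜 X]

/-- A basis is shrinking as soon as all functionals have tails tending to `0` in norm. -/
theorem isShrinking_of_tendsto (x : SchauderBasis 𝕜 X) (h : ∀ f : StrongDual 𝕜 X,
    Tendsto (fun n => ‖f - f.comp (SchauderBasis.proj x n)‖) atTop (𝓝 0)) : IsShrinking x := by
  -- The coefficients of `f` are its values at the `x n`, so its partial sums are the functionals f
  -- ∘ proj n.
  refine ⟨⟨x.coord, fun n => NormedSpace.inclusionInDoubleDual 𝕜 X (x n), fun i j => ?_,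
    fun f => ?_⟩, fun n => rfl⟩
  · have h1 : x.coord j (x i) = _ := x.ortho j i
    change x.coord j (x i) = _
    rcases eq_or_ne i j with rfl | hij
    · exact h1
    · simp [h1, hij, hij.symm]
  · rw [HasSum, SummationFilter.conditional_filter_eq_map_range, tendsto_map'_iff,
      tendsto_iff_norm_sub_tendsto_zero]
    refine (h f).congr fun n => ?_
    rw [norm_sub_rev]
    congr 2
    ext y
    simp only [Function.comp, ContinuousLinearMap.comp_apply, SchauderBasis.proj_apply, map_sum,
      map_smul, smul_eq_mul, sum_apply, smul_apply,
      NormedSpace.dual_def]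
    exact Finset.sum_congr rfl fun i _ => mul_comm _ _

/-- A functional whose tails do not tend to `0` is equal to `1` along some bounded sequence of
blocks. -/
theorem exists_block_apply_eq_one [CompleteSpace X] (x : SchauderBasis 𝕜 X) {f : StrongDual 𝕜 X}
    (hf : ¬ Tendsto (fun n => ‖f - f.comp (SchauderBasis.proj x n)‖) atTop (𝓝 0)) :
    ∃ (p : ℕ → ℕ) (a : ℕ → 𝕜) (u : ℕ → X) (R : ℝ), StrictMono p ∧
      (∀ j, u j = ∑ n ∈ Finset.Ico (p j) (p (j + 1)), a n • x n) ∧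
      (∀ j, f (u j) = 1) ∧ ∀ j, ‖u j‖ ≤ R := by
  obtain ⟨C, hC1, hC⟩ := SchauderBasis.exists_proj_bound x
  obtain ⟨δ, hδ, hfδ⟩ : ∃ δ > 0, ∀ N, ∃ n ≥ N, δ ≤ ‖f - f.comp (SchauderBasis.proj x n)‖ := by
    rw [Metric.tendsto_atTop] at hf
    push Not at hf
    simpa using hf
  have hstep : ∀ N, ∃ m > N, ∃ z : X, SchauderBasis.proj x m z = z ∧
      SchauderBasis.proj x N z = 0 ∧ f z = 1 ∧ ‖z‖ ≤ (δ / 2)⁻¹ * (2 * C) := by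
    intro N
    obtain ⟨n, hnN, hn⟩ := hfδ N
    -- A nearly norming vector for the tail of `f`; truncating it far out keeps `‖f w‖` above `δ /
    -- 2`, and dividing by `f w` costs at most the factor (δ / 2)⁻¹.
    obtain ⟨y, hy, hfy⟩ := (f - f.comp (SchauderBasis.proj x n)).exists_lt_apply_of_lt_opNorm
      (show δ / 2 < _ by linarith)
    have hlim : Tendsto (fun m => ‖f (SchauderBasis.proj x m y - SchauderBasis.proj x n y)‖) atTop
        (𝓝 ‖f (y - SchauderBasis.proj x n y)‖) :=
      ((f.continuous.tendsto _).comp ((SchauderBasis.tendsto_proj x y).sub_const _)).norm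
    have hfy' : δ / 2 < ‖f (y - SchauderBasis.proj x n y)‖ := by simpa using hfy
    obtain ⟨m, hm, hmn⟩ := ((hlim.eventually_const_lt hfy').and (eventually_gt_atTop n)).exists
    set w := SchauderBasis.proj x m y - SchauderBasis.proj x n y
    have hpos : 0 < ‖f w‖ := lt_trans (by positivity) hm
    refine ⟨m, hnN.trans_lt hmn, (f w)⁻¹ • w, ?_, ?_, ?_, ?_⟩
    · simp only [w, map_smul, map_sub, SchauderBasis.proj_comp, min_self, min_eq_right hmn.le]
    · simp only [w, map_smul, map_sub, SchauderBasis.proj_comp, min_eq_left hnN,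
        min_eq_left (hnN.trans hmn.le), sub_self, smul_zero]
    · rw [map_smul, smul_eq_mul, inv_mul_cancel₀ (norm_pos_iff.1 hpos)]
    · rw [norm_smul, norm_inv]
      have hw : ‖w‖ ≤ 2 * C := by
        rw [two_mul]
        refine norm_sub_le_of_le ((hC _ _).trans ?_) ((hC _ _).trans ?_) <;>
          exact mul_le_of_le_one_right (by linarith) hy.le
      gcongr
  choose nxt hnxt z hz1 hz2 hz3 hz4 using hstep
  let p : ℕ → ℕ := fun k => nxt^[k] 0
  have hpsucc : ∀ k, p (k + 1) = nxt (p k) := fun k => Function.iterate_succ_apply' _ _ _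
  have hp : StrictMono p := strictMono_nat_of_lt_succ fun k => by
    rw [hpsucc]
    exact hnxt _
  obtain ⟨a, ha⟩ := SchauderBasis.exists_coeff_of_proj_sub x hp fun j => z (p j)
  refine ⟨p, a, fun j => z (p j), _, hp, fun j => ?_, fun j => hz3 _, fun j => hz4 _⟩
  rw [← ha j, hpsucc, hz1, hz2, sub_zero]

/-- By Tonelli the expected total norm is at most ∑ 2⁻ᵏ, hence the total is almost surely finite. -/
theorem ae_summable_norm_of_integral_le {W : ℕ → (ℕ → ℤˣ) → X}
    (hW : ∀ k, StronglyMeasurable (W k)) (hWi : ∀ k, Integrable (W k) signMeasure)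
    (h : ∀ k, ∫ ε, ‖W k ε‖ ∂signMeasure ≤ 2⁻¹ ^ k) :
    ∀ᵐ ε ∂signMeasure, Summable fun k => ‖W k ε‖ := by
  have h1 : ∫⁻ ε, ∑' k, ‖W k ε‖ₑ ∂signMeasure ≠ ⊤ := by
    rw [lintegral_tsum fun k => (hW k).enorm.aemeasurable]
    refine ne_top_of_le_ne_top (b := ∑' k : ℕ, (2 : ENNReal)⁻¹ ^ k)
      (by rw [ENNReal.tsum_geometric]; simp) (ENNReal.tsum_le_tsum fun k => ?_)
    rw [← ofReal_integral_norm_eq_lintegral_enorm (hWi k)]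
    refine (ENNReal.ofReal_le_ofReal (h k)).trans (le_of_eq ?_)
    rw [ENNReal.ofReal_pow (by norm_num), ENNReal.ofReal_inv_of_pos (by norm_num)]
    simp
  filter_upwards [ae_lt_top (Measurable.tsum fun k => (hW k).enorm) h1] with ε hε
  simpa using ENNReal.summable_toReal hε.ne

theorem isShrinking_of_not_contains_lp_one [CompleteSpace X] (x : SchauderBasis 𝕜 X)
    (hx : ∀ u : ℕ → X, IsBlockSubsequence 𝕜 x u → IsRUD 𝕜 u)
    (hcopy : ¬ ContainsIsomorphicCopy 𝕜 X (lp (fun _ : ℕ => 𝕜) 1)) : IsShrinking x := by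
  classical
  refine isShrinking_of_tendsto x fun f => ?_
  by_contra hf
  obtain ⟨p, a, u, R, hp, hu, hfu, huR⟩ := exists_block_apply_eq_one x hf
  have hblock : IsBlockSubsequence 𝕜 x u := ⟨p, a, hp, fun j => ⟨hu j, fun h0 => by
    have := hfu j
    rw [h0, map_zero] at this
    exact zero_ne_one this⟩⟩
  obtain ⟨C, hC1, hC⟩ := SchauderBasis.exists_proj_bound x
  choose F b hFN hb1 hbint using fun (k N : ℕ) =>
    exists_convexCombination_integral_norm_le huR hcopy (η := 2⁻¹ ^ k) (by positivity) N
  obtain ⟨q, hq, hq0, hqF⟩ : ∃ q : ℕ → ℕ, StrictMono q ∧ q 0 = 0 ∧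
      ∀ k, ∀ n ∈ F k (q k), n < q (k + 1) := by
    let q : ℕ → ℕ := fun k => Nat.rec (motive := fun _ => ℕ) 0
      (fun k N => max (N + 1) ((F k N).sup id + 1)) k
    exact ⟨q, strictMono_nat_of_lt_succ fun k => lt_of_lt_of_le (Nat.lt_succ_self _)
      (le_max_left _ _), rfl, fun k n hn => lt_of_lt_of_le
        (Nat.lt_succ_of_le (Finset.le_sup (f := id) hn)) (le_max_right _ _)⟩
  let lev : ℕ → ℕ := fun j => Nat.findGreatest (fun i => q i ≤ j) j
  have hlev : ∀ k j, q k ≤ j → j < q (k + 1) → lev j = k := fun k j h1 h2 =>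
    Nat.findGreatest_eq_of_mem_Ico hq h1 h2
  have hlevspec : ∀ j, q (lev j) ≤ j := fun j =>
    Nat.findGreatest_spec (P := fun i => q i ≤ j) (Nat.zero_le j) (by rw [hq0]; exact j.zero_le)
  have hlevlt : ∀ j, j < q (lev j + 1) := fun j => by
    by_contra! h
    have := Nat.le_findGreatest (P := fun i => q i ≤ j) ((hq.id_le _).trans h) h
    exact absurd this (by simp [lev])
  have hlevlim : Tendsto lev atTop atTop := tendsto_atTop_atTop.2 fun k =>
    ⟨q k, fun j hj => Nat.le_findGreatest ((hq.id_le _).trans hj) hj⟩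
  -- The combinations chosen on successive intervals are concatenated, with coefficient 0 off their
  -- supports.
  let c : ℕ → ℝ := fun n => if n ∈ F (lev n) (q (lev n)) then b (lev n) (q (lev n)) n else 0
  have hcsum : ∀ (k : ℕ) (y : ℕ → X), ∑ n ∈ Finset.Ico (q k) (q (k + 1)), (c n : 𝕜) • y n =
      ∑ n ∈ F k (q k), (b k (q k) n : 𝕜) • y n := fun k y => by
    have hsub : F k (q k) ⊆ Finset.Ico (q k) (q (k + 1)) := fun n hn =>
      Finset.mem_Ico.2 ⟨hFN k (q k) n hn, hqF k n hn⟩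
    have hlevk : ∀ n ∈ Finset.Ico (q k) (q (k + 1)), lev n = k := fun n hn =>
      hlev k n (Finset.mem_Ico.1 hn).1 (Finset.mem_Ico.1 hn).2
    rw [← Finset.sum_subset hsub fun n hn hnF => by
      simp only [c, hlevk n hn, if_neg hnF, RCLike.ofReal_zero, zero_smul]]
    refine Finset.sum_congr rfl fun n hn => ?_
    simp only [c, hlevk n (hsub hn), if_pos hn]
  -- On every full interval the coefficients sum to 1, so `f` is 1 on its sum and the Cauchy
  -- criterion fails.
  have hdiv : ¬ SeriesConverges fun n => (c n : 𝕜) • u n := by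
    intro hconv
    obtain ⟨N, hN⟩ := hconv.exists_norm_sum_Ico_lt (δ := (‖f‖ + 1)⁻¹) (by positivity)
    have h1 := hN (q N) (q (N + 1)) (hq.id_le N) (hq.monotone N.le_succ)
    have h2 : f (∑ n ∈ Finset.Ico (q N) (q (N + 1)), (c n : 𝕜) • u n) = 1 := by
      rw [hcsum, map_sum]
      simp only [map_smul, hfu, smul_eq_mul, mul_one]
      rw [← RCLike.ofReal_sum, hb1, RCLike.ofReal_one]
    have h3 := f.le_opNorm (∑ n ∈ Finset.Ico (q N) (q (N + 1)), (c n : 𝕜) • u n)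
    rw [h2, norm_one] at h3
    have h4 : (‖f‖ + 1) * ‖∑ n ∈ Finset.Ico (q N) (q (N + 1)), (c n : 𝕜) • u n‖ < 1 := by
      rwa [← lt_div_iff₀' (by positivity), one_div]
    have h5 := norm_nonneg (∑ n ∈ Finset.Ico (q N) (q (N + 1)), (c n : 𝕜) • u n)
    linarith
  refine hdiv ((hx u hblock).convergent _ ?_)
  let W : ℕ → (ℕ → ℤˣ) → X := fun k ε =>
    ∑ n ∈ F k (q k), ε n • ((b k (q k) n : 𝕜) • u n)
  have hWm : ∀ k, StronglyMeasurable (W k) := fun k => stronglyMeasurable_sum_sign_smul _ _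
  have hWi : ∀ k, Integrable (W k) signMeasure := fun k =>
    Integrable.of_bound (hWm k).aestronglyMeasurable
      (∑ n ∈ F k (q k), ‖(b k (q k) n : 𝕜) • u n‖) (Eventually.of_forall fun ε =>
        norm_sum_le_of_le _ fun n _ => (norm_sign_smul _ _).le)
  filter_upwards [ae_summable_norm_of_integral_le hWm hWi fun k => hbint k (q k)] with ε hε
  let d : ℕ → X := fun n => ε n • ((c n : 𝕜) • u n)
  have hW : ∀ k, W k ε = ∑ n ∈ Finset.Ico (q k) (q (k + 1)), d n := fun k => by
    simp only [W, d, smul_comm (ε _), hcsum k fun n => ε n • u n]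
  have hproj : ∀ k N, q k ≤ N → N < q (k + 1) →
      SchauderBasis.proj x (p N) (W k ε) = ∑ n ∈ Finset.Ico (q k) N, d n := by
    intro k N h1 h2
    have hd : ∀ n, SchauderBasis.proj x (p N) (d n) = if n < N then d n else 0 := fun n => by
      simp only [d, sign_smul_eq (𝕜 := 𝕜), map_smul, SchauderBasis.proj_block x hp.monotone hu]
      split_ifs <;> simp
    rw [hW, map_sum]
    simp only [hd]
    rw [← Finset.sum_filter]
    congr 1
    ext n
    simp only [Finset.mem_filter, Finset.mem_Ico]
    omega
  have hV := hε.of_norm.hasSum.tendsto_sum_nat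
  refine ⟨∑' k, W k ε, ?_⟩
  have hsplit : ∀ N, ∑ n ∈ Finset.range N, d n =
      ∑ k ∈ Finset.range (lev N), W k ε + SchauderBasis.proj x (p N) (W (lev N) ε) := fun N => by
    rw [hproj _ N (hlevspec N) (hlevlt N)]
    simp only [hW]
    rw [sum_range_sum_Ico_eq hq.monotone, hq0,
      Finset.sum_Ico_consecutive _ (Nat.zero_le _) (hlevspec N), Finset.range_eq_Ico]
  -- An incomplete interval contributes a basis projection of the full sum `W`, hence at most `C`
  -- times its norm.
  have hrest : Tendsto (fun N => SchauderBasis.proj x (p N) (W (lev N) ε)) atTop (𝓝 0) := by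
    have h1 : Tendsto (fun N => C * ‖W (lev N) ε‖) atTop (𝓝 (C * 0)) :=
      (hε.tendsto_atTop_zero.comp hlevlim).const_mul C
    rw [mul_zero] at h1
    exact squeeze_zero_norm (fun N => hC _ _) h1
  have h2 := (hV.comp hlevlim).add hrest
  rw [add_zero] at h2
  exact h2.congr fun N => (hsplit N).symm

theorem not_contains_lp_one_of_isShrinking (x : SchauderBasis 𝕜 X) (hx : IsShrinking x) :
    ¬ ContainsIsomorphicCopy 𝕜 X (lp (fun _ : ℕ => 𝕜) 1) := by
  classical
  rintro ⟨Y, ⟨e⟩⟩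
  obtain ⟨c, -⟩ := hx
  have hsep : TopologicalSpace.SeparableSpace (StrongDual 𝕜 X) := by
    have h1 : TopologicalSpace.IsSeparable
        (closure (Submodule.span 𝕜 (Set.range c) : Set (StrongDual 𝕜 X))) :=
      ((Set.countable_range c).isSeparable.span).closure
    have h2 : closure (Submodule.span 𝕜 (Set.range c) : Set (StrongDual 𝕜 X)) = Set.univ := by
      refine Set.eq_univ_of_forall fun f => mem_closure_of_tendsto
        (SchauderBasis.tendsto_proj c f) (Eventually.of_forall fun n => ?_)
      rw [SchauderBasis.proj_apply]
      exact Submodule.sum_mem _ fun i _ => Submodule.smul_mem _ _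
        (Submodule.subset_span ⟨i, rfl⟩)
    rw [h2] at h1
    exact TopologicalSpace.isSeparable_univ_iff.1 h1
  have hnorm : ∀ v : lp (fun _ : ℕ => 𝕜) 1, HasSum (fun i => ‖v i‖) ‖v‖ := fun v => by
    simpa using lp.hasSum_norm (p := 1) (by simp) v
  have hsum : ∀ (A : Set ℕ) (v : lp (fun _ : ℕ => 𝕜) 1), Summable fun i => A.indicator v i :=
    fun A v => (hnorm v).summable.of_norm.indicator A
  let g : Set ℕ → StrongDual 𝕜 (lp (fun _ : ℕ => 𝕜) 1) := fun A =>
    LinearMap.mkContinuous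
      { toFun := fun v => ∑' i, A.indicator v i
        map_add' := fun v w => by
          rw [← (hsum A v).tsum_add (hsum A w), lp.coeFn_add]
          simp only [Set.indicator_add']
          rfl
        map_smul' := fun r v => by
          rw [lp.coeFn_smul]
          refine Eq.trans (tsum_congr fun i => ?_) ((hsum A v).tsum_const_smul r)
          simp [Set.indicator_apply] } 1 (fun v => by
        rw [one_mul]
        exact tsum_of_norm_bounded (hnorm v) fun i => norm_indicator_le_norm_self _ _)
  have hg : ∀ (A : Set ℕ) (n : ℕ), g A (lp.single 1 n 1) = if n ∈ A then 1 else 0 := by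
    intro A n
    change ∑' i, A.indicator (lp.single 1 n (1 : 𝕜) : lp (fun _ : ℕ => 𝕜) 1) i = _
    rw [tsum_eq_single n fun i hi => by simp [Set.indicator_apply, lp.single_apply, hi]]
    simp [Set.indicator_apply]
  choose G hG using fun A => exists_extension_norm_eq Y ((g A).comp (e : Y →L[𝕜] _))
  let y : ℕ → X := fun n => e.symm (lp.single 1 n 1)
  have hGy : ∀ (A : Set ℕ) (n : ℕ), G A (y n) = if n ∈ A then 1 else 0 := fun A n => by
    rw [← hg, (hG A).1]
    simp
  obtain ⟨κ, hκ, hyκ⟩ : ∃ κ > 0, ∀ n, ‖y n‖ ≤ κ := by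
    refine ⟨‖(e.symm : lp (fun _ : ℕ => 𝕜) 1 →L[𝕜] Y)‖ + 1, by positivity, fun n => ?_⟩
    have h1 := (e.symm : lp (fun _ : ℕ => 𝕜) 1 →L[𝕜] Y).le_opNorm (lp.single 1 n 1)
    rw [lp.norm_single (by simp), norm_one, mul_one] at h1
    exact h1.trans (by linarith)
  choose i hi using fun A => (Metric.denseRange_iff.1
    (TopologicalSpace.denseRange_denseSeq (StrongDual 𝕜 X))) (G A) (2 * κ)⁻¹ (by positivity)
  -- If `G A` and `G B` are close to the same term of the dense sequence, their values at each `y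
  -- n`, all 0 or 1, differ by less than 1; then `A = B`, and subsets of ℕ would inject into ℕ.
  refine Function.cantor_injective i fun A B hAB => ?_
  have hdist : ‖G A - G B‖ < κ⁻¹ := by
    rw [← dist_eq_norm]
    have h1 := dist_triangle_right (G A) (G B) (TopologicalSpace.denseSeq (StrongDual 𝕜 X) (i A))
    have h2 := hi A
    have h3 := hi B
    rw [← hAB] at h3
    have : κ⁻¹ = (2 * κ)⁻¹ + (2 * κ)⁻¹ := by
      field_simp
      norm_num
    linarith
  have hlt : ∀ n, ‖(G A - G B) (y n)‖ < 1 := fun n => by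
    calc ‖(G A - G B) (y n)‖ ≤ ‖G A - G B‖ * ‖y n‖ := (G A - G B).le_opNorm _
      _ ≤ ‖G A - G B‖ * κ := by
        gcongr
        exact hyκ n
      _ < κ⁻¹ * κ := by gcongr
      _ = 1 := inv_mul_cancel₀ hκ.ne'
  ext n
  have h := hlt n
  rw [sub_apply, hGy, hGy] at h
  by_contra hne
  by_cases hA : n ∈ A <;> by_cases hB : n ∈ B <;> simp [hA, hB] at h hne

end

theorem theorem2p12 {𝕜 : Type*} [RCLike 𝕜] {X : Type*} [NormedAddCommGroup X] [NormedSpace 𝕜 X]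
    [CompleteSpace X] (x : SchauderBasis 𝕜 X) :
    ((∀ u : ℕ → X, IsBlockSubsequence 𝕜 x u → IsRUD 𝕜 u) →
      (IsShrinking x ↔ ¬ ContainsIsomorphicCopy 𝕜 X (lp (fun _ : ℕ => 𝕜) 1))) ∧
    ((∀ u : ℕ → X, IsBlockSubsequence 𝕜 x u → IsRUC 𝕜 u) →
      (IsBoundedlyComplete x ↔ ¬ ContainsIsomorphicCopy 𝕜 X C₀(ℕ, 𝕜))) :=
  ⟨fun h => ⟨not_contains_lp_one_of_isShrinking x, isShrinking_of_not_contains_lp_one x h⟩,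
    fun h => ⟨not_contains_zeroAtInfty_of_isBoundedlyComplete x,
      isBoundedlyComplete_of_not_contains_zeroAtInfty x h⟩⟩
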